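/- Fix $k\in(0,1)$ and put $k'=\sqrt{1-k^2}$, $F(\varphi,k)=\int_0^{\varphi}\frac{dt}{\sqrt{1-k^2\sin^2 t}}$, $K=F(\pi/2,k)$, $K'=F(\pi/2,k')$, $q=e^{-\pi K'/K}$. For $x\in\mathbb{C}$ let $$H(x)=\theta_1\!\left(\tfrac{\pi x}{2K}\right),\qquad \Theta(x)=\theta_4\!\left(\tfrac{\pi x}{2K}\right),\qquad \mathrm{cn}(x,k)=\frac{\theta_4(0)}{\theta_2(0)}\,\frac{\theta_2(\pi x/2K)}{\theta_4(\pi x/2K)},$$ where $$\theta_1(u)=2\sum_{n\ge1}(-1)^{n-1}q^{(n-1/2)^2}\sin(2n-1)u,\quad \theta_2(u)=2\sum_{n\ge1}q^{(n-1/2)^2}\cos(2n-1)u,\quad \theta_4(u)=1+2\sum_{n\ge1}(-1)^nq^{n^2}\cos 2nu .$$ Let $\lambda\in\mathbb{R}$ and let $\alpha\in\mathbb{C}$ be any solution (not a pole of $\mathrm{cn}$) of the characteristic equation $$\lambda=1-2k^2+k^2\,\mathrm{cn}^2(\alpha,k),$$ or the following explicit value: $\alpha=F(\varphi_\alpha,k)$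 with $\varphi_\alpha\in[0,\frac{\pi}{2}]$, $\sin\varphi_\alpha=\frac{\sqrt{1-k^2-\lambda}}{k}$, if $\lambda\in[1-2k^2,1-k^2]$; $\alpha=K+iF(\varphi_\beta,k')$ with $\varphi_\beta\in[0,\frac{\pi}{2}]$, $\sin\varphi_\beta=\frac{\sqrt{1-2k^2-\lambda}}{\sqrt{(1-k^2)(1-k^2-\lambda)}}$, if $\lambda\in[-k^2,1-2k^2]$; $\alpha=K+iK'+F(\varphi_\gamma,k)$ with $\varphi_\gamma\in[0,\frac{\pi}{2})$, $\sin\varphi_\gamma=\frac{\sqrt{-k^2-\lambda}}{\sqrt{1-2k^2-\lambda}}$, if $\lambda\le -k^2$. Define $$\omega(\alpha)=4(\lambda+k^2-1)\left[\frac{\Theta'(\alpha)}{\Theta(\alpha)}-\frac{H'(\alpha)}{H(\alpha)}\right].$$ If $\lambda\in(-\infty,-k^2)\cup(1-2k^2,1-k^2)$, then $\Theta(\alpha)\neq0$, $H(\alpha)\ne0$ and $\omega(\alpha)\in\mathbb{R}$. If $\lambda\in[-k^2,1-2k^2]$, then $\Theta(\alpha)\neq0$, $H(\alpha)\ne0$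 and $\omega(\alpha)\in i\mathbb{R}$. -/

import Mathlib

noncomputable section

namespace LameKdV

/-- Incomplete elliptic integral of the first kind `F(φ, k)`. -/
def ellipticF (φ k : ℝ) : ℝ :=
  ∫ t in (0 : ℝ)..φ, 1 / Real.sqrt (1 - k ^ 2 * Real.sin t ^ 2)

/-- Complete elliptic integral of the first kind `K(k)`. -/
def ellipticK (k : ℝ) : ℝ := ellipticF (Real.pi / 2) k

/-- Complementary modulus `k' = √(1 - k²)`. -/
def compl (k : ℝ) : ℝ := Real.sqrt (1 - k ^ 2)

/-- `K'(k) = K(k')`. -/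
def ellipticK' (k : ℝ) : ℝ := ellipticK (compl k)

/-- The Jacobi nome `q = exp(-π K'(k) / K(k))`. -/
def nome (k : ℝ) : ℝ := Real.exp (-(Real.pi * ellipticK' k / ellipticK k))

/-- `θ₁(u) = 2 ∑_{n ≥ 1} (-1)^{n-1} q^{(n-1/2)²} sin((2n-1)u)` (with the index shifted by one). -/
def theta1 (q : ℝ) (u : ℂ) : ℂ :=
  2 * ∑' n : ℕ, (-1 : ℂ) ^ n * ((q ^ (((n : ℝ) + 1 / 2) ^ 2) : ℝ) : ℂ) *
    Complex.sin ((2 * (n : ℂ) + 1) * u)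

/-- `θ₂(u) = 2 ∑_{n ≥ 1} q^{(n-1/2)²} cos((2n-1)u)` (with the index shifted by one). -/
def theta2 (q : ℝ) (u : ℂ) : ℂ :=
  2 * ∑' n : ℕ, ((q ^ (((n : ℝ) + 1 / 2) ^ 2) : ℝ) : ℂ) *
    Complex.cos ((2 * (n : ℂ) + 1) * u)

/-- `θ₄(u) = 1 + 2 ∑_{n ≥ 1} (-1)^n q^{n²} cos(2nu)` (with the index shifted by one). -/
def theta4 (q : ℝ) (u : ℂ) : ℂ :=
  1 + 2 * ∑' n : ℕ, (-1 : ℂ) ^ (n + 1) * ((q ^ ((n + 1) ^ 2) : ℝ) : ℂ) *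
    Complex.cos (2 * ((n : ℂ) + 1) * u)

/-- The rescaled argument `π x / (2 K(k))`. -/
def scaledArg (k : ℝ) (x : ℂ) : ℂ := (Real.pi : ℂ) * x / (2 * (ellipticK k : ℂ))

/-- Jacobi's eta function `H(x) = θ₁(π x / (2K))`. -/
def jacobiH (k : ℝ) (x : ℂ) : ℂ := theta1 (nome k) (scaledArg k x)

/-- Jacobi's theta function `Θ(x) = θ₄(π x / (2K))`. -/
def jacobiTheta (k : ℝ) (x : ℂ) : ℂ := theta4 (nome k) (scaledArg k x)

/-- The Jacobi elliptic function `cn(x, k)` of a complex argument, by the classical theta quotient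
`cn(x, k) = (θ₄(0) / θ₂(0)) · (θ₂(ζ) / θ₄(ζ))`, `ζ = π x / (2K)`. Its poles are the zeros of `Θ`. -/
def jacobiCn (k : ℝ) (x : ℂ) : ℂ :=
  theta4 (nome k) 0 / theta2 (nome k) 0 *
    (theta2 (nome k) (scaledArg k x) / theta4 (nome k) (scaledArg k x))

/-- `α` is not a pole of `cn` and solves the characteristic equation
`λ = 1 - 2k² + k² cn²(α, k)`. -/
def CharacteristicEq (k lam : ℝ) (α : ℂ) : Prop :=
  jacobiTheta k α ≠ 0 ∧ (lam : ℂ) = 1 - 2 * (k : ℂ) ^ 2 + (k : ℂ) ^ 2 * jacobiCn k α ^ 2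

/-- The explicit choice of the parameter `α` along the path on which `λ` decreases from `1 - k²`
to `-∞`: `α ∈ [0, K]`, then `α = K + iβ` with `β ∈ [0, K']`, then `α = K + iK' + γ` with
`γ ∈ [0, K)`. (Only used for `λ ≤ 1 - k²`; adjacent formulas agree at the band edges.) -/
def pathAlpha (k lam : ℝ) : ℂ :=
  if 1 - 2 * k ^ 2 ≤ lam then
    (ellipticF (Real.arcsin (Real.sqrt (1 - k ^ 2 - lam) / k)) k : ℂ)
  else if -k ^ 2 ≤ lam then
    (ellipticK k : ℂ) + Complex.I *
      (ellipticF (Real.arcsin (Real.sqrt (1 - 2 * k ^ 2 - lam) /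
        Real.sqrt ((1 - k ^ 2) * (1 - k ^ 2 - lam)))) (compl k) : ℂ)
  else
    (ellipticK k : ℂ) + Complex.I * (ellipticK' k : ℂ) +
      (ellipticF (Real.arcsin (Real.sqrt (-k ^ 2 - lam) /
        Real.sqrt (1 - 2 * k ^ 2 - lam))) k : ℂ)

/-- The temporal frequency
`ω(α) = 4(λ + k² - 1) [Θ'(α)/Θ(α) - H'(α)/H(α)]`. -/
def omega (k lam : ℝ) (α : ℂ) : ℂ :=
  4 * ((lam : ℂ) + (k : ℂ) ^ 2 - 1) *
    (deriv (jacobiTheta k) α / jacobiTheta k α - deriv (jacobiH k) α / jacobiH k α)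

end LameKdV

end

/-!
A solution `α` of the characteristic equation has `k² cn² α = λ - 1 + 2k²`, hence also
`k² sn² α = 1 - k² - λ` and `dn² α = λ + k²`. Up to a constant factor `sn = H / Θ`, so `H'/H - Θ'/Θ`
is the logarithmic derivative `cn dn / sn` of `sn`, and `ω(α) = 4k² sn α cn α dn α`. Therefore
`ω(α)²` is the real cubic `16 (1 - k² - λ)(λ - 1 + 2k²)(λ + k²)`, whose sign decides whether `ω(α)`
is real or purely imaginary.

These identities are proved for theta functions with period ratio `τ = it`. Every `k ∈ (0, 1)` is
`θ₂(0)² / θ₃(0)²` for some `t > 0`. Since `sn` inverts `F(·, k)` and Jacobi's imaginary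
transformation exchanges `t` with `1/t` and `k` with `k'`, one gets `K' = tK` and `q = exp(-πt)`;
the same two facts show that the explicit `α` solves the characteristic equation.
-/

noncomputable section

open Complex Real Set Filter Topology
open scoped ComplexConjugate ComplexOrder

namespace LameKdV

/-! ### Theta functions -/

/-- The theta function `θ₃(πz)` with parameter `τ`. In `vartheta₁`, …, `vartheta₄` the argument is
scaled so that the half-periods are `1/2` and `τ/2`, as in Mathlib's `jacobiTheta₂`. -/
def vartheta₃ (τ z : ℂ) : ℂ := jacobiTheta₂ z τ

/-- The multiplier by which translation by the half-period `τ/2` permutes the theta functions. -/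
def halfPeriodFactor (τ z : ℂ) : ℂ := cexp (π * I * (τ / 4 + z))

/-- The theta function `θ₂(πz)` with parameter `τ`. -/
def vartheta₂ (τ z : ℂ) : ℂ := halfPeriodFactor τ z * vartheta₃ τ (z + τ / 2)

/-- The theta function `θ₄(πz)` with parameter `τ`. -/
def vartheta₄ (τ z : ℂ) : ℂ := vartheta₃ τ (z + 1 / 2)

/-- The theta function `θ₁(πz)` with parameter `τ`. -/
def vartheta₁ (τ z : ℂ) : ℂ := vartheta₂ τ (z - 1 / 2)

section Translations

variable (τ z : ℂ)

lemma halfPeriodFactor_ne_zero : halfPeriodFactor τ z ≠ 0 := Complex.exp_ne_zero _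

lemma halfPeriodFactor_add_half : halfPeriodFactor τ (z + 1 / 2) = I * halfPeriodFactor τ z := by
  rw [halfPeriodFactor,
    show π * I * (τ / 4 + (z + 1 / 2)) = π / 2 * I + π * I * (τ / 4 + z) by ring, Complex.exp_add,
    Complex.exp_pi_div_two_mul_I, halfPeriodFactor]

lemma halfPeriodFactor_add_one : halfPeriodFactor τ (z + 1) = -halfPeriodFactor τ z := by
  rw [show z + 1 = z + 1 / 2 + 1 / 2 by ring, halfPeriodFactor_add_half, halfPeriodFactor_add_half,
    ← mul_assoc, I_mul_I, neg_one_mul]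

lemma halfPeriodFactor_mul (w : ℂ) :
    halfPeriodFactor τ z * halfPeriodFactor τ w = halfPeriodFactor (2 * τ) (z + w) := by
  simp only [halfPeriodFactor, ← Complex.exp_add]
  ring_nf

lemma vartheta₃_add_one : vartheta₃ τ (z + 1) = vartheta₃ τ z := jacobiTheta₂_add_left z τ

lemma vartheta₃_neg : vartheta₃ τ (-z) = vartheta₃ τ z := jacobiTheta₂_neg_left z τ

lemma vartheta₃_add_period :
    vartheta₃ τ (z + τ) = cexp (-π * I * (τ + 2 * z)) * vartheta₃ τ z :=
  jacobiTheta₂_add_left' z τ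

lemma vartheta₂_add_half_period :
    halfPeriodFactor τ z * vartheta₂ τ (z + τ / 2) = vartheta₃ τ z := by
  rw [vartheta₂, add_assoc z, add_halves, vartheta₃_add_period, halfPeriodFactor, halfPeriodFactor,
    ← mul_assoc, ← mul_assoc, ← Complex.exp_add, ← Complex.exp_add]
  ring_nf
  simp

lemma vartheta₂_neg : vartheta₂ τ (-z) = vartheta₂ τ z := by
  rw [vartheta₂, vartheta₂, ← vartheta₃_neg τ (-z + τ / 2),
    show z + τ / 2 = -(-z + τ / 2) + τ by ring, vartheta₃_add_period, halfPeriodFactor,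
    halfPeriodFactor, ← mul_assoc, ← Complex.exp_add]
  ring_nf

lemma vartheta₂_add_one : vartheta₂ τ (z + 1) = -vartheta₂ τ z := by
  rw [vartheta₂, halfPeriodFactor_add_one, add_right_comm, vartheta₃_add_one, neg_mul, vartheta₂]

lemma vartheta₂_half : vartheta₂ τ (1 / 2) = 0 := by
  have h := vartheta₂_add_one τ (-(1 / 2))
  rw [show -(1 / 2 : ℂ) + 1 = 1 / 2 by norm_num, vartheta₂_neg] at h
  exact self_eq_neg.mp h

lemma vartheta₂_add_half : vartheta₂ τ (z + 1 / 2) = -vartheta₁ τ z := by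
  rw [vartheta₁, ← vartheta₂_add_one, show z - 1 / 2 + 1 = z + 1 / 2 by ring]

lemma vartheta₁_add_half : vartheta₁ τ (z + 1 / 2) = vartheta₂ τ z := by
  rw [vartheta₁, add_sub_cancel_right]

lemma vartheta₃_sub_half : vartheta₃ τ (z - 1 / 2) = vartheta₄ τ z := by
  rw [vartheta₄, ← vartheta₃_add_one, show z - 1 / 2 + 1 = z + 1 / 2 by ring]

lemma vartheta₄_add_half : vartheta₄ τ (z + 1 / 2) = vartheta₃ τ z := by
  rw [← vartheta₃_sub_half, add_sub_cancel_right]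

lemma vartheta₁_zero : vartheta₁ τ 0 = 0 := by
  rw [vartheta₁, zero_sub, vartheta₂_neg, vartheta₂_half]

lemma halfPeriodFactor_eq_I_mul_sub_half :
    halfPeriodFactor τ z = I * halfPeriodFactor τ (z - 1 / 2) := by
  rw [← halfPeriodFactor_add_half, sub_add_cancel]

lemma vartheta₄_add_half_period :
    halfPeriodFactor τ z * vartheta₄ τ (z + τ / 2) = I * vartheta₁ τ z := by
  rw [halfPeriodFactor_eq_I_mul_sub_half, ← vartheta₃_sub_half, vartheta₁, vartheta₂,
    show z + τ / 2 - 1 / 2 = z - 1 / 2 + τ / 2 by ring, mul_assoc]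

lemma vartheta₂_add_half_add_half_period :
    halfPeriodFactor τ z * vartheta₂ τ (z + 1 / 2 + τ / 2) = -I * vartheta₄ τ z := by
  have h := vartheta₂_add_half_period τ (z + 1 / 2)
  rw [halfPeriodFactor_add_half, ← vartheta₄] at h
  linear_combination -I * h + halfPeriodFactor τ z * vartheta₂ τ (z + 1 / 2 + τ / 2) * I_sq

lemma vartheta₄_add_half_add_half_period :
    halfPeriodFactor τ z * vartheta₄ τ (z + 1 / 2 + τ / 2) = vartheta₂ τ z := by
  rw [add_right_comm, vartheta₄_add_half, vartheta₂]

end Translations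

lemma differentiable_vartheta₃ {τ : ℂ} (hτ : 0 < τ.im) : Differentiable ℂ (vartheta₃ τ) := fun z =>
  differentiableAt_jacobiTheta₂_fst z hτ

lemma differentiable_vartheta₂ {τ : ℂ} (hτ : 0 < τ.im) : Differentiable ℂ (vartheta₂ τ) := by
  have := differentiable_vartheta₃ hτ
  unfold vartheta₂ halfPeriodFactor
  fun_prop

lemma differentiable_vartheta₁ {τ : ℂ} (hτ : 0 < τ.im) : Differentiable ℂ (vartheta₁ τ) := by
  have := differentiable_vartheta₂ hτ
  unfold vartheta₁
  fun_prop

lemma differentiable_vartheta₄ {τ : ℂ} (hτ : 0 < τ.im) : Differentiable ℂ (vartheta₄ τ) := by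
  have := differentiable_vartheta₃ hτ
  unfold vartheta₄
  fun_prop

/-! ### Product formulas -/

/-- The two families parametrise the pairs of integers of equal, respectively opposite, parity. -/
lemma bijective_sum_elim_add_sub : Function.Bijective
    (Sum.elim (fun p : ℤ × ℤ => (p.1 + p.2, p.1 - p.2))
      (fun p : ℤ × ℤ => (p.1 + p.2 + 1, p.1 - p.2))) := by
  constructor
  · rintro (⟨a, b⟩ | ⟨a, b⟩) (⟨c, d⟩ | ⟨c, d⟩) h <;>
      simp only [Sum.elim_inl, Sum.elim_inr, Prod.mk.injEq] at h <;>
      simp only [Sum.inl.injEq, Sum.inr.injEq, Prod.mk.injEq, reduceCtorEq] <;> omega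
  · rintro ⟨m, n⟩
    rcases Int.even_or_odd' (m + n) with ⟨a, ha | ha⟩
    · exact ⟨Sum.inl (a, a - n), by simp only [Sum.elim_inl, Prod.mk.injEq]; omega⟩
    · exact ⟨Sum.inr (a, a - n), by simp only [Sum.elim_inr, Prod.mk.injEq]; omega⟩

lemma hasSum_vartheta₃_mul_vartheta₃ {τ : ℂ} (hτ : 0 < τ.im) (x y : ℂ) :
    HasSum (fun p : ℤ × ℤ => jacobiTheta₂_term p.1 x τ * jacobiTheta₂_term p.2 y τ)
      (vartheta₃ τ x * vartheta₃ τ y) := by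
  have summable_norm (z : ℂ) : Summable fun n : ℤ => ‖jacobiTheta₂_term n z τ‖ :=
    ((summable_jacobiTheta₂_term_iff z τ).mpr hτ).norm
  rw [vartheta₃, jacobiTheta₂, vartheta₃, jacobiTheta₂,
    tsum_mul_tsum_of_summable_norm (summable_norm x) (summable_norm y)]
  exact (summable_mul_of_summable_norm (summable_norm x) (summable_norm y)).hasSum

theorem vartheta₃_mul_vartheta₃ {τ : ℂ} (hτ : 0 < τ.im) (x y : ℂ) :
    vartheta₃ τ x * vartheta₃ τ y =
      vartheta₃ (2 * τ) (x + y) * vartheta₃ (2 * τ) (x - y) +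
        vartheta₂ (2 * τ) (x + y) * vartheta₂ (2 * τ) (x - y) := by
  have h2τ : 0 < (2 * τ).im := by simpa using hτ
  have hsum := hasSum_vartheta₃_mul_vartheta₃ hτ x y
  rw [← (Equiv.ofBijective _ bijective_sum_elim_add_sub).hasSum_iff] at hsum
  refine hsum.unique (HasSum.sum ?_ ?_)
  · refine (hasSum_vartheta₃_mul_vartheta₃ h2τ (x + y) (x - y)).congr_fun fun p => ?_
    simp only [Function.comp_apply, Equiv.ofBijective_apply, Sum.elim_inl, jacobiTheta₂_term,
      ← Complex.exp_add]
    congr 1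
    push_cast
    ring
  · rw [vartheta₂, vartheta₂, mul_mul_mul_comm]
    refine ((hasSum_vartheta₃_mul_vartheta₃ h2τ
      (x + y + 2 * τ / 2) (x - y + 2 * τ / 2)).mul_left
        (halfPeriodFactor (2 * τ) (x + y) * halfPeriodFactor (2 * τ) (x - y))).congr_fun fun p => ?_
    simp only [Function.comp_apply, Equiv.ofBijective_apply, Sum.elim_inr, jacobiTheta₂_term,
      halfPeriodFactor, ← Complex.exp_add]
    congr 1
    push_cast
    ring

theorem vartheta₂_mul_vartheta₂ {τ : ℂ} (hτ : 0 < τ.im) (x y : ℂ) :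
    vartheta₂ τ x * vartheta₂ τ y =
      vartheta₃ (2 * τ) (x + y) * vartheta₂ (2 * τ) (x - y) +
        vartheta₂ (2 * τ) (x + y) * vartheta₃ (2 * τ) (x - y) := by
  have h := vartheta₃_mul_vartheta₃ hτ (x + τ / 2) (y + τ / 2)
  rw [show x + τ / 2 + (y + τ / 2) = x + y + 2 * τ / 2 by ring, add_sub_add_right_eq_sub] at h
  rw [← vartheta₂_add_half_period (2 * τ) (x + y), ← halfPeriodFactor_mul, vartheta₂.eq_1 τ x,
    vartheta₂.eq_1 τ y, mul_mul_mul_comm, h, vartheta₂.eq_1 (2 * τ) (x + y),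
    ← halfPeriodFactor_mul]
  ring

section Squares

variable {τ : ℂ} (hτ : 0 < τ.im) (z : ℂ)
include hτ

lemma vartheta₃_sq : vartheta₃ τ z ^ 2 = vartheta₃ (2 * τ) 0 * vartheta₃ (2 * τ) (2 * z) +
    vartheta₂ (2 * τ) 0 * vartheta₂ (2 * τ) (2 * z) := by
  rw [sq, vartheta₃_mul_vartheta₃ hτ, sub_self, two_mul z]
  ring

lemma vartheta₂_sq : vartheta₂ τ z ^ 2 = vartheta₂ (2 * τ) 0 * vartheta₃ (2 * τ) (2 * z) +
    vartheta₃ (2 * τ) 0 * vartheta₂ (2 * τ) (2 * z) := by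
  rw [sq, vartheta₂_mul_vartheta₂ hτ, sub_self, two_mul z]
  ring

lemma vartheta₄_sq : vartheta₄ τ z ^ 2 = vartheta₃ (2 * τ) 0 * vartheta₃ (2 * τ) (2 * z) -
    vartheta₂ (2 * τ) 0 * vartheta₂ (2 * τ) (2 * z) := by
  rw [vartheta₄, vartheta₃_sq hτ, show 2 * (z + 1 / 2) = 2 * z + 1 by ring, vartheta₃_add_one,
    vartheta₂_add_one]
  ring

lemma vartheta₁_sq : vartheta₁ τ z ^ 2 = vartheta₂ (2 * τ) 0 * vartheta₃ (2 * τ) (2 * z) -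
    vartheta₃ (2 * τ) 0 * vartheta₂ (2 * τ) (2 * z) := by
  rw [← neg_sq, ← vartheta₂_add_half, vartheta₂_sq hτ, show 2 * (z + 1 / 2) = 2 * z + 1 by ring,
    vartheta₃_add_one, vartheta₂_add_one]
  ring

/-- This is `sn² + cn² = 1`. -/
theorem vartheta₁_sq_add_vartheta₂_sq :
    vartheta₁ τ z ^ 2 * vartheta₃ τ 0 ^ 2 + vartheta₂ τ z ^ 2 * vartheta₄ τ 0 ^ 2 =
      vartheta₄ τ z ^ 2 * vartheta₂ τ 0 ^ 2 := by
  simp only [vartheta₁_sq hτ, vartheta₂_sq hτ, vartheta₃_sq hτ, vartheta₄_sq hτ, mul_zero]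
  ring

/-- This is `k² sn² + dn² = 1`. -/
theorem vartheta₁_sq_add_vartheta₃_sq :
    vartheta₁ τ z ^ 2 * vartheta₂ τ 0 ^ 2 + vartheta₃ τ z ^ 2 * vartheta₄ τ 0 ^ 2 =
      vartheta₄ τ z ^ 2 * vartheta₃ τ 0 ^ 2 := by
  simp only [vartheta₁_sq hτ, vartheta₂_sq hτ, vartheta₃_sq hτ, vartheta₄_sq hτ, mul_zero]
  ring

theorem vartheta₂_pow_four_add_vartheta₄_pow_four :
    vartheta₂ τ 0 ^ 4 + vartheta₄ τ 0 ^ 4 = vartheta₃ τ 0 ^ 4 := by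
  simp only [show 4 = 2 * 2 from rfl, pow_mul, vartheta₂_sq hτ, vartheta₃_sq hτ, vartheta₄_sq hτ,
    mul_zero]
  ring

theorem vartheta₁_mul_vartheta₂ :
    vartheta₁ τ z * vartheta₂ τ z = vartheta₄ (2 * τ) 0 * vartheta₁ (2 * τ) (2 * z) := by
  rw [vartheta₁, vartheta₂_mul_vartheta₂ hτ, show z - 1 / 2 - z = -(1 / 2) by ring, vartheta₂_neg,
    vartheta₂_half, vartheta₃_neg, vartheta₄, vartheta₁,
    show z - 1 / 2 + z = 2 * z - 1 / 2 by ring, zero_add]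
  ring

end Squares

/-! ### The Wronskian of `θ₁` and `θ₄` -/

/-- The theta function with characteristic `1/4` and parameter `2τ`, that is
`∑ₙ exp(2πiτ(n + 1/4)² + 2πi(n + 1/4)z)`. Both `θ₁(x)θ₄(y)` and `θ₂(x)θ₃(y)` are bilinear in its
values at `±(x + y)` and `±(x - y)`. -/
def quarterTheta (τ z : ℂ) : ℂ :=
  cexp (π * I * (τ / 8 + z / 2)) * vartheta₃ (2 * τ) (z + τ / 2)

lemma quarterTheta_neg (τ z : ℂ) :
    quarterTheta τ (-z) = cexp (π * I * (τ / 8 + z / 2)) * vartheta₂ (2 * τ) (z + τ / 2) := by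
  rw [quarterTheta, vartheta₂, halfPeriodFactor, ← vartheta₃_neg,
    show -(-z + τ / 2) = z - τ / 2 by ring,
    show z + τ / 2 + 2 * τ / 2 = z - τ / 2 + 2 * τ by ring, vartheta₃_add_period,
    ← mul_assoc, ← mul_assoc, ← Complex.exp_add, ← Complex.exp_add]
  ring_nf

lemma quarterTheta_add_one (τ z : ℂ) : quarterTheta τ (z + 1) = I * quarterTheta τ z := by
  rw [quarterTheta, quarterTheta, add_right_comm, vartheta₃_add_one,
    show π * I * (τ / 8 + (z + 1) / 2) = π * I * (τ / 8 + z / 2) + π / 2 * I by ring,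
    Complex.exp_add _ (π / 2 * I), Complex.exp_pi_div_two_mul_I]
  ring

lemma differentiable_quarterTheta {τ : ℂ} (hτ : 0 < τ.im) : Differentiable ℂ (quarterTheta τ) := by
  have := differentiable_vartheta₃ (τ := 2 * τ) (by simpa using hτ)
  unfold quarterTheta
  fun_prop

lemma vartheta₂_mul_vartheta₃ {τ : ℂ} (hτ : 0 < τ.im) (x y : ℂ) :
    vartheta₂ τ x * vartheta₃ τ y =
      quarterTheta τ (x + y) * quarterTheta τ (x - y) +
        quarterTheta τ (-(x + y)) * quarterTheta τ (-(x - y)) := by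
  have h := vartheta₃_mul_vartheta₃ hτ (x + τ / 2) y
  have hexp : halfPeriodFactor τ x =
      cexp (π * I * (τ / 8 + (x + y) / 2)) * cexp (π * I * (τ / 8 + (x - y) / 2)) := by
    rw [halfPeriodFactor, ← Complex.exp_add]
    ring_nf
  rw [add_right_comm, add_sub_right_comm] at h
  rw [quarterTheta_neg, quarterTheta_neg, quarterTheta, quarterTheta, vartheta₂, mul_assoc, h, hexp]
  ring

lemma vartheta₁_mul_vartheta₄ {τ : ℂ} (hτ : 0 < τ.im) (x y : ℂ) :
    vartheta₁ τ x * vartheta₄ τ y =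
      -I * (quarterTheta τ (x + y) * quarterTheta τ (x - y) -
        quarterTheta τ (-(x + y)) * quarterTheta τ (-(x - y))) := by
  have h := quarterTheta_add_one τ (x - y - 1)
  rw [sub_add_cancel] at h
  rw [vartheta₁, vartheta₄, vartheta₂_mul_vartheta₃ hτ, sub_add_add_cancel,
    show x - 1 / 2 - (y + 1 / 2) = x - y - 1 by ring, neg_sub, sub_eq_neg_add 1,
    quarterTheta_add_one, h]
  linear_combination quarterTheta τ (x + y) * quarterTheta τ (x - y - 1) * I_sq

lemma hasDerivAt_add_mul_sub {f g : ℂ → ℂ} (hf : Differentiable ℂ f) (hg : Differentiable ℂ g)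
    (z : ℂ) :
    HasDerivAt (fun y => f (z + y) * g (z - y)) (deriv f z * g z - f z * deriv g z) 0 := by
  have hf' := (hf (z + 0)).hasDerivAt.comp_const_add z 0
  have hg' := (hg (z - 0)).hasDerivAt.comp_const_sub z 0
  refine (hf'.mul hg').congr_deriv ?_
  rw [add_zero, sub_zero]
  ring

lemma wronskian_eq_quarterTheta {τ : ℂ} (hτ : 0 < τ.im) (z : ℂ) :
    deriv (vartheta₁ τ) z * vartheta₄ τ z - vartheta₁ τ z * deriv (vartheta₄ τ) z =
      -2 * I * deriv (quarterTheta τ) 0 * (quarterTheta τ (2 * z) + quarterTheta τ (-(2 * z))) := by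
  have hA (c : ℂ) : HasDerivAt (fun y => quarterTheta τ (c * y))
      (c * deriv (quarterTheta τ) 0) 0 := by
    have h := (differentiable_quarterTheta hτ (c * 0)).hasDerivAt.comp (0 : ℂ)
      ((hasDerivAt_id (0 : ℂ)).const_mul c)
    rwa [mul_zero, mul_one, mul_comm] at h
  have hprod (y : ℂ) : vartheta₁ τ (z + y) * vartheta₄ τ (z - y) =
      -I * (quarterTheta τ (2 * z) * quarterTheta τ (2 * y) -
        quarterTheta τ (-(2 * z)) * quarterTheta τ (-2 * y)) := by
    rw [vartheta₁_mul_vartheta₄ hτ]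
    ring_nf
  have h := hasDerivAt_add_mul_sub (differentiable_vartheta₁ hτ) (differentiable_vartheta₄ hτ) z
  rw [funext hprod] at h
  rw [h.unique ((((hA 2).const_mul (quarterTheta τ (2 * z))).sub
    ((hA (-2)).const_mul (quarterTheta τ (-(2 * z))))).const_mul (-I))]
  ring

/-- This is the formula `sn' = cn · dn`, up to normalisation. -/
theorem wronskian_vartheta₁_vartheta₄ {τ : ℂ} (hτ : 0 < τ.im) (z : ℂ) :
    (deriv (vartheta₁ τ) z * vartheta₄ τ z - vartheta₁ τ z * deriv (vartheta₄ τ) z) *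
        (vartheta₂ τ 0 * vartheta₃ τ 0) =
      deriv (vartheta₁ τ) 0 * vartheta₄ τ 0 * (vartheta₂ τ z * vartheta₃ τ z) := by
  have hself (z : ℂ) : vartheta₂ τ z * vartheta₃ τ z =
      quarterTheta τ 0 * (quarterTheta τ (2 * z) + quarterTheta τ (-(2 * z))) := by
    rw [vartheta₂_mul_vartheta₃ hτ, sub_self, neg_zero, two_mul]
    ring
  have hzero := wronskian_eq_quarterTheta hτ 0
  rw [vartheta₁_zero, zero_mul, sub_zero, mul_zero, neg_zero] at hzero
  rw [wronskian_eq_quarterTheta hτ, hzero, hself, hself, mul_zero, neg_zero]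
  ring

/-! ### Jacobi's imaginary transformation -/

/-- The common factor in the imaginary transformation of the theta functions. -/
def modularFactor (τ u : ℂ) : ℂ := 1 / (-I * τ) ^ (1 / 2 : ℂ) * cexp (-π * I * τ * u ^ 2)

lemma modularFactor_ne_zero {τ : ℂ} (hτ : τ ≠ 0) (u : ℂ) : modularFactor τ u ≠ 0 := by
  refine mul_ne_zero (one_div_ne_zero ?_) (Complex.exp_ne_zero _)
  rw [Ne, Complex.cpow_eq_zero_iff, not_and_or]
  exact Or.inl (mul_ne_zero (neg_ne_zero.mpr I_ne_zero) hτ)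

lemma modularFactor_add_half (τ u : ℂ) :
    modularFactor τ (u + 1 / 2) * halfPeriodFactor τ (τ * u) = modularFactor τ u := by
  rw [modularFactor, modularFactor, halfPeriodFactor, mul_assoc (1 / _), ← Complex.exp_add]
  ring_nf

lemma modularFactor_add_half_period {τ : ℂ} (hτ : τ ≠ 0) (u : ℂ) :
    modularFactor τ (u + -1 / τ / 2) = modularFactor τ u * halfPeriodFactor (-1 / τ) u := by
  rw [modularFactor, modularFactor, halfPeriodFactor, mul_assoc (1 / _), ← Complex.exp_add]
  congr 2
  field_simp
  ring

section ImaginaryTransformation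

variable {τ : ℂ} (hτ : τ ≠ 0) (u : ℂ)
include hτ

lemma vartheta₃_mul_left : vartheta₃ τ (τ * u) = modularFactor τ u * vartheta₃ (-1 / τ) u := by
  rw [vartheta₃, vartheta₃, modularFactor, jacobiTheta₂_functional_equation,
    mul_div_cancel_left₀ u hτ]
  congr 3
  field_simp

lemma vartheta₂_mul_left : vartheta₂ τ (τ * u) = modularFactor τ u * vartheta₄ (-1 / τ) u := by
  rw [vartheta₂, show τ * u + τ / 2 = τ * (u + 1 / 2) by ring, vartheta₃_mul_left hτ,
    ← modularFactor_add_half τ u, vartheta₄]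
  ring

lemma vartheta₄_mul_left : vartheta₄ τ (τ * u) = modularFactor τ u * vartheta₂ (-1 / τ) u := by
  rw [← vartheta₃_sub_half, show τ * u - 1 / 2 = τ * (u + -1 / τ / 2) by field_simp; ring,
    vartheta₃_mul_left hτ, modularFactor_add_half_period hτ, vartheta₂]
  ring

lemma vartheta₁_mul_left :
    vartheta₁ τ (τ * u) = I * modularFactor τ u * vartheta₁ (-1 / τ) u := by
  rw [vartheta₁, show τ * u - 1 / 2 = τ * (u + -1 / τ / 2) by field_simp; ring,
    vartheta₂_mul_left hτ, modularFactor_add_half_period hτ, mul_assoc, vartheta₄_add_half_period]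
  ring

end ImaginaryTransformation

/-! ### Trigonometric series -/

lemma hasSum_vartheta₂ {τ : ℂ} (hτ : 0 < τ.im) (z : ℂ) :
    HasSum (fun n : ℕ => 2 * (cexp (π * I * τ * (n + 1 / 2) ^ 2) *
      Complex.cos ((2 * n + 1) * (π * z)))) (vartheta₂ τ z) := by
  refine ((hasSum_jacobiTheta₂_term (z + τ / 2) hτ).mul_left
    (halfPeriodFactor τ z)).nat_add_neg_add_one.congr_fun fun n => ?_
  rw [mul_left_comm, Complex.two_cos, halfPeriodFactor, jacobiTheta₂_term, jacobiTheta₂_term]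
  simp only [mul_add (cexp _), ← Complex.exp_add]
  congr 2 <;>
  · push_cast
    ring

lemma hasSum_vartheta₁ {τ : ℂ} (hτ : 0 < τ.im) (z : ℂ) :
    HasSum (fun n : ℕ => 2 * ((-1) ^ n * cexp (π * I * τ * (n + 1 / 2) ^ 2) *
      Complex.sin ((2 * n + 1) * (π * z)))) (vartheta₁ τ z) := by
  refine (hasSum_vartheta₂ hτ (z - 1 / 2)).congr_fun fun n => ?_
  rw [show (2 * n + 1) * (π * (z - 1 / 2)) = (2 * n + 1) * (π * z) - π / 2 - n * π by ring,
    Complex.cos_antiperiodic.sub_nat_mul_eq, Complex.cos_sub_pi_div_two]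
  ring

lemma hasSum_vartheta₃ {τ : ℂ} (hτ : 0 < τ.im) (z : ℂ) :
    HasSum (fun n : ℕ => 2 * (cexp (π * I * τ * (n + 1) ^ 2) *
      Complex.cos (2 * (n + 1) * (π * z)))) (vartheta₃ τ z - 1) := by
  have h := (hasSum_jacobiTheta₂_term z hτ).nat_add_neg
  rw [← hasSum_nat_add_iff' 1, Finset.sum_range_one, Nat.cast_zero, neg_zero,
    show jacobiTheta₂_term 0 z τ = 1 by simp [jacobiTheta₂_term], add_sub_add_right_eq_sub] at h
  refine h.congr_fun fun n => ?_
  rw [mul_left_comm, Complex.two_cos, jacobiTheta₂_term, jacobiTheta₂_term]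
  simp only [mul_add (cexp _), ← Complex.exp_add]
  congr 2 <;>
  · push_cast
    ring

lemma hasSum_vartheta₄ {τ : ℂ} (hτ : 0 < τ.im) (z : ℂ) :
    HasSum (fun n : ℕ => 2 * ((-1) ^ (n + 1) * cexp (π * I * τ * (n + 1) ^ 2) *
      Complex.cos (2 * (n + 1) * (π * z)))) (vartheta₄ τ z - 1) := by
  refine (hasSum_vartheta₃ hτ (z + 1 / 2)).congr_fun fun n => ?_
  rw [show 2 * (n + 1) * (π * (z + 1 / 2)) = 2 * (n + 1) * (π * z) + (n + 1 : ℕ) * π by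
    push_cast; ring, Complex.cos_antiperiodic.add_nat_mul_eq]
  ring

/-! ### Positivity on the imaginary axis -/

lemma im_I_mul_ofReal_pos {t : ℝ} (ht : 0 < t) : 0 < (I * (t : ℂ)).im := by simpa using ht

lemma two_mul_I_mul_ofReal (t : ℝ) : 2 * (I * (t : ℂ)) = I * (2 * t : ℝ) := by
  push_cast
  ring

lemma neg_one_div_I_mul_ofReal (t : ℝ) : -1 / (I * (t : ℂ)) = I * (t⁻¹ : ℝ) := by
  rw [neg_div, one_div, mul_inv, inv_I, neg_mul, neg_neg, ofReal_inv]

section Conj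

variable (t : ℝ) (z : ℂ)

lemma vartheta₃_conj : conj (vartheta₃ (I * t) z) = vartheta₃ (I * t) (conj z) := by
  rw [vartheta₃, jacobiTheta₂_conj, vartheta₃, map_mul, conj_I, conj_ofReal, neg_mul, neg_neg]

lemma vartheta₂_conj : conj (vartheta₂ (I * t) z) = vartheta₂ (I * t) (conj z) := by
  rw [← vartheta₂_neg _ (conj z), vartheta₂, vartheta₂, map_mul, vartheta₃_conj, ← vartheta₃_neg,
    halfPeriodFactor, halfPeriodFactor, ← Complex.exp_conj]
  simp only [map_add, map_mul, map_div₀, conj_ofReal, conj_I, map_ofNat]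
  ring_nf

lemma vartheta₁_conj : conj (vartheta₁ (I * t) z) = vartheta₁ (I * t) (conj z) := by
  simp only [vartheta₁, vartheta₂_conj, map_sub, map_div₀, map_one, map_ofNat]

lemma vartheta₄_conj : conj (vartheta₄ (I * t) z) = vartheta₄ (I * t) (conj z) := by
  simp only [vartheta₄, vartheta₃_conj, map_add, map_div₀, map_one, map_ofNat]

end Conj

lemma evenKernel_pos (a : UnitAddCircle) {t : ℝ} (ht : 0 < t) : 0 < HurwitzZeta.evenKernel a t := by
  induction a using QuotientAddGroup.induction_on with
  | H a =>
    have h := HurwitzZeta.hasSum_int_evenKernel a ht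
    exact h.tsum_eq ▸ h.summable.tsum_pos (fun n => (Real.exp_pos _).le) 0 (Real.exp_pos _)

lemma cosKernel_pos (a : UnitAddCircle) {t : ℝ} (ht : 0 < t) : 0 < HurwitzZeta.cosKernel a t := by
  have h := HurwitzZeta.evenKernel_functional_equation a (1 / t)
  rw [one_div_one_div] at h
  exact (pos_iff_pos_of_mul_pos (h ▸ evenKernel_pos a (one_div_pos.mpr ht))).mp (by positivity)

lemma vartheta₃_ofReal (t u : ℝ) : vartheta₃ (I * t) u = HurwitzZeta.cosKernel u t :=
  (HurwitzZeta.cosKernel_def u t).symm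

lemma vartheta₂_zero (t : ℝ) : vartheta₂ (I * t) 0 = HurwitzZeta.evenKernel (1 / 2 : ℝ) t := by
  rw [HurwitzZeta.evenKernel_def, vartheta₂, halfPeriodFactor, vartheta₃]
  congr 2
  · push_cast
    linear_combination π * t / 4 * I_sq
  · push_cast
    ring

section Positivity

variable {t : ℝ} (ht : 0 < t)
include ht

lemma vartheta₃_ofReal_pos (u : ℝ) : 0 < vartheta₃ (I * t) u := by
  rw [vartheta₃_ofReal, zero_lt_real]
  exact cosKernel_pos u ht

lemma vartheta₄_ofReal_pos (u : ℝ) : 0 < vartheta₄ (I * t) u := by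
  simpa [vartheta₄] using vartheta₃_ofReal_pos ht (u + 1 / 2)

lemma vartheta₂_zero_pos : 0 < vartheta₂ (I * t) 0 := by
  rw [vartheta₂_zero, zero_lt_real]
  exact evenKernel_pos _ ht

lemma vartheta₃_zero_pos : 0 < vartheta₃ (I * t) 0 := by
  simpa using vartheta₃_ofReal_pos ht 0

lemma vartheta₄_zero_pos : 0 < vartheta₄ (I * t) 0 := by
  simpa using vartheta₄_ofReal_pos ht 0

end Positivity

/-! ### The zeros of `θ₁` -/

lemma abs_sin_nat_mul_le (n : ℕ) (x : ℝ) : |Real.sin (n * x)| ≤ n * |Real.sin x| := by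
  induction n with
  | zero => simp
  | succ n ih =>
    rw [Nat.cast_succ, add_one_mul, add_one_mul, Real.sin_add]
    refine (abs_add_le _ _).trans (add_le_add ?_ ?_)
    · rw [abs_mul]
      exact (mul_le_of_le_one_right (abs_nonneg _) (Real.abs_cos_le_one _)).trans ih
    · rw [abs_mul]
      exact mul_le_of_le_one_left (abs_nonneg _) (Real.abs_cos_le_one _)

lemma two_mul_add_one_le_three_pow (n : ℕ) : 2 * n + 1 ≤ 3 ^ n := by
  induction n with
  | zero => simp
  | succ n ih => rw [pow_succ]; omega

lemma ne_zero_of_hasSum_of_norm_le_geometric {E : Type*} [NormedAddCommGroup E] {f : ℕ → E}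
    {s : E} {r : ℝ} (hs : HasSum f s) (hf : f 0 ≠ 0) (hr₀ : 0 ≤ r) (hr : r < 1 / 2)
    (hle : ∀ n, ‖f n‖ ≤ ‖f 0‖ * r ^ n) : s ≠ 0 := by
  rintro rfl
  have htail : HasSum (fun n => f (n + 1)) (-f 0) := by
    simpa using (hasSum_nat_add_iff' 1).mpr hs
  have hgeom : HasSum (fun n => ‖f 0‖ * r ^ (n + 1)) (‖f 0‖ * (r * (1 - r)⁻¹)) := by
    simpa only [pow_succ'] using
      ((hasSum_geometric_of_lt_one hr₀ (by linarith)).mul_left r).mul_left ‖f 0‖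
  have hbound : ‖f 0‖ ≤ ‖f 0‖ * (r * (1 - r)⁻¹) := by
    simpa only [norm_neg] using htail.norm_le_of_bounded hgeom fun n => hle (n + 1)
  have hratio : r * (1 - r)⁻¹ < 1 := by
    rw [← div_eq_mul_inv, div_lt_one (by linarith)]
    linarith
  exact hbound.not_gt (mul_lt_of_lt_one_right (norm_pos_iff.mpr hf) hratio)

lemma exp_mul_abs_sin_le {t : ℝ} (ht : 0 ≤ t) (x : ℝ) (n : ℕ) :
    rexp (-(π * t * (n + 1 / 2) ^ 2)) * |Real.sin ((2 * n + 1) * x)| ≤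
      rexp (-(π * t / 4)) * |Real.sin x| * (3 * rexp (-(2 * π * t))) ^ n := by
  have hexp : rexp (-(π * t * (n + 1 / 2) ^ 2)) ≤
      rexp (-(π * t / 4)) * rexp (-(2 * π * t)) ^ n := by
    rw [← Real.exp_nat_mul, ← Real.exp_add, Real.exp_le_exp]
    have hn : (n : ℝ) ≤ n ^ 2 := mod_cast Nat.le_self_pow two_ne_zero n
    nlinarith [mul_nonneg (mul_nonneg pi_pos.le ht) (sub_nonneg.mpr hn)]
  have hsin : |Real.sin ((2 * n + 1) * x)| ≤ 3 ^ n * |Real.sin x| := by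
    refine le_trans (mod_cast abs_sin_nat_mul_le (2 * n + 1) x)
      (mul_le_mul_of_nonneg_right ?_ (abs_nonneg _))
    exact_mod_cast two_mul_add_one_le_three_pow n
  calc
    _ ≤ rexp (-(π * t / 4)) * rexp (-(2 * π * t)) ^ n * (3 ^ n * |Real.sin x|) := by gcongr
    _ = _ := by rw [mul_pow]; ring

lemma three_mul_exp_neg_two_pi_mul_lt {t : ℝ} (ht : 1 ≤ t) : 3 * rexp (-(2 * π * t)) < 1 / 2 := by
  have hpi : 6 < 2 * π * t := by nlinarith [pi_gt_three]
  have hexp : 6 < rexp (2 * π * t) := hpi.trans (by linarith [Real.add_one_le_exp (2 * π * t)])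
  rw [Real.exp_neg, ← div_eq_mul_inv, div_lt_iff₀ (Real.exp_pos _)]
  linarith

lemma vartheta₁_ofReal_ne_zero_of_one_le {t : ℝ} (ht : 1 ≤ t) {u : ℝ} (hu : u ∈ Ioo 0 1) :
    vartheta₁ (I * t) u ≠ 0 := by
  have ht₀ : 0 < t := by linarith
  have hsin : 0 < Real.sin (π * u) :=
    Real.sin_pos_of_pos_of_lt_pi (mul_pos pi_pos hu.1) (by nlinarith [pi_pos, hu.2])
  set f : ℕ → ℂ := fun n =>
    2 * ((-1) ^ n * cexp (π * I * (I * t) * (n + 1 / 2) ^ 2) * Complex.sin ((2 * n + 1) * (π * u)))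
  have hf : HasSum f (vartheta₁ (I * t) u) := hasSum_vartheta₁ (im_I_mul_ofReal_pos ht₀) u
  have hnorm (n : ℕ) :
      ‖f n‖ = 2 * (rexp (-(π * t * (n + 1 / 2) ^ 2)) * |Real.sin ((2 * n + 1) * (π * u))|) := by
    have hexp : cexp (π * I * (I * t) * (n + 1 / 2) ^ 2) =
        rexp (-(π * t * (n + 1 / 2) ^ 2)) := by
      push_cast
      congr 1
      linear_combination π * t * (n + 1 / 2) ^ 2 * I_sq
    have hsin : Complex.sin ((2 * n + 1) * (π * u)) = Real.sin ((2 * n + 1) * (π * u)) := by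
      push_cast; rfl
    simp only [f, hexp, hsin, norm_mul, norm_pow, norm_neg, norm_one, one_pow, one_mul,
      norm_real, Complex.norm_ofNat, Real.norm_eq_abs, Real.abs_exp]
  have hnorm_zero : ‖f 0‖ = 2 * (rexp (-(π * t / 4)) * |Real.sin (π * u)|) := by
    rw [hnorm]
    norm_num [div_eq_mul_inv]
  refine ne_zero_of_hasSum_of_norm_le_geometric hf ?_ (by positivity)
    (three_mul_exp_neg_two_pi_mul_lt ht) fun n => ?_
  · rw [← norm_pos_iff, hnorm_zero]
    positivity
  · rw [hnorm, hnorm_zero, mul_assoc 2]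
    exact mul_le_mul_of_nonneg_left (exp_mul_abs_sin_le ht₀.le _ n) zero_le_two

lemma vartheta₁_one_sub (τ z : ℂ) : vartheta₁ τ (1 - z) = vartheta₁ τ z := by
  rw [vartheta₁, vartheta₁, ← vartheta₂_neg]
  ring_nf

/-- The duplication formula `θ₁θ₂(τ, z) = θ₄(2τ, 0) θ₁(2τ, 2z)` carries a zero of `θ₁` at `it` to
one at `2it`, and hence, after finitely many steps, into the range where the series is dominated by
its first term. -/
lemma vartheta₁_ofReal_ne_zero {t : ℝ} (ht : 0 < t) {u : ℝ} (hu : u ∈ Ioo 0 1) :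
    vartheta₁ (I * t) u ≠ 0 := by
  obtain ⟨n, hn⟩ : ∃ n : ℕ, 1 ≤ 2 ^ n * t :=
    (pow_unbounded_of_one_lt (1 / t) one_lt_two).imp fun n hn => ((div_lt_iff₀ ht).mp hn).le
  induction n generalizing t u with
  | zero => exact vartheta₁_ofReal_ne_zero_of_one_le (by simpa using hn) hu
  | succ n ih =>
    wlog hhalf : u ≤ 1 / 2 generalizing u
    · rw [← vartheta₁_one_sub, ← ofReal_one, ← ofReal_sub]
      exact this ⟨by linarith [hu.2], by linarith [hu.1]⟩ (by linarith)
    rcases hhalf.eq_or_lt with rfl | hlt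
    · push_cast
      rw [vartheta₁, sub_self]
      exact (vartheta₂_zero_pos ht).ne'
    · have hdouble : vartheta₁ (I * (2 * t : ℝ)) (2 * u : ℝ) ≠ 0 :=
        ih (by positivity) ⟨by linarith [hu.1], by linarith⟩ (by rw [pow_succ] at hn; linarith)
      have hfour : vartheta₄ (I * (2 * t : ℝ)) 0 ≠ 0 := (vartheta₄_zero_pos (by positivity)).ne'
      refine left_ne_zero_of_mul (b := vartheta₂ (I * t) u) ?_
      rw [vartheta₁_mul_vartheta₂ (im_I_mul_ofReal_pos ht), two_mul_I_mul_ofReal]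
      rw [ofReal_mul 2 u] at hdouble
      exact mul_ne_zero hfour hdouble

lemma vartheta₂_ofReal_pos {t : ℝ} (ht : 0 < t) {u : ℝ} (hu : u ∈ Ico 0 (1 / 2)) :
    0 < vartheta₂ (I * t) u := by
  have hreal (x : ℝ) : vartheta₂ (I * t) x = (vartheta₂ (I * t) x).re :=
    (conj_eq_iff_re.mp (by rw [vartheta₂_conj, conj_ofReal])).symm
  have hne (x : ℝ) (hx : x ∈ Ico 0 (1 / 2)) : vartheta₂ (I * t) x ≠ 0 := by
    have h := vartheta₁_ofReal_ne_zero ht (u := x + 1 / 2)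
      ⟨by linarith [hx.1], by linarith [hx.2]⟩
    push_cast at h
    rwa [vartheta₁_add_half] at h
  have hcont : Continuous fun x : ℝ => (vartheta₂ (I * t) x).re :=
    continuous_re.comp ((differentiable_vartheta₂ (im_I_mul_ofReal_pos ht)).continuous.comp
      continuous_ofReal)
  have hzero : 0 < (vartheta₂ (I * t) (0 : ℝ)).re := by
    rw [← zero_lt_real, ← hreal, ofReal_zero]
    exact vartheta₂_zero_pos ht
  rw [hreal, zero_lt_real]
  by_contra! hneg
  obtain ⟨x, hx, hx₀⟩ := intermediate_value_Icc' hu.1 hcont.continuousOn ⟨hneg, hzero.le⟩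
  refine hne x ⟨hx.1, hx.2.trans_lt hu.2⟩ ?_
  rw [hreal]
  exact congrArg ofReal hx₀

/-! ### The modulus -/

/-- The elliptic modulus `θ₂(0)² / θ₃(0)²` of the lattice with period ratio `τ = it`; the kernels
are the values of `θ₂` and `θ₃` at `0` as real numbers. -/
def modulus (t : ℝ) : ℝ :=
  (HurwitzZeta.evenKernel (1 / 2 : ℝ) t / HurwitzZeta.cosKernel 0 t) ^ 2

lemma ofReal_modulus (t : ℝ) :
    (modulus t : ℂ) = (vartheta₂ (I * t) 0 / vartheta₃ (I * t) 0) ^ 2 := by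
  have h₃ : vartheta₃ (I * t) 0 = HurwitzZeta.cosKernel 0 t := by
    simpa using vartheta₃_ofReal t 0
  rw [modulus, vartheta₂_zero, h₃, ofReal_pow, ofReal_div]

lemma modulus_pos {t : ℝ} (ht : 0 < t) : 0 < modulus t :=
  pow_pos (div_pos (evenKernel_pos _ ht) (cosKernel_pos _ ht)) 2

lemma ofReal_modulus_inv {t : ℝ} (ht : 0 < t) :
    (modulus t⁻¹ : ℂ) = (vartheta₄ (I * t) 0 / vartheta₃ (I * t) 0) ^ 2 := by
  have hτ : I * (t : ℂ) ≠ 0 := mul_ne_zero I_ne_zero (ofReal_ne_zero.mpr ht.ne')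
  have h₃ := vartheta₃_mul_left hτ 0
  have h₄ := vartheta₄_mul_left hτ 0
  rw [mul_zero, neg_one_div_I_mul_ofReal] at h₃ h₄
  rw [ofReal_modulus, h₃, h₄, mul_div_mul_left _ _ (modularFactor_ne_zero hτ 0)]

lemma modulus_sq_add_modulus_inv_sq {t : ℝ} (ht : 0 < t) :
    modulus t ^ 2 + modulus t⁻¹ ^ 2 = 1 := by
  have h₃ := (vartheta₃_zero_pos ht).ne'
  have h := vartheta₂_pow_four_add_vartheta₄_pow_four (im_I_mul_ofReal_pos ht)
  rw [← ofReal_inj]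
  push_cast
  rw [ofReal_modulus, ofReal_modulus_inv ht, ← pow_mul, ← pow_mul, div_pow, div_pow, ← add_div, h,
    div_self (pow_ne_zero _ h₃)]

lemma modulus_sq_lt_one {t : ℝ} (ht : 0 < t) : modulus t ^ 2 < 1 := by
  nlinarith [modulus_sq_add_modulus_inv_sq ht, modulus_pos (inv_pos.mpr ht)]

lemma compl_modulus {t : ℝ} (ht : 0 < t) : compl (modulus t) = modulus t⁻¹ := by
  rw [compl, ← modulus_sq_add_modulus_inv_sq ht, add_sub_cancel_left,
    Real.sqrt_sq (modulus_pos (inv_pos.mpr ht)).le]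

lemma tendsto_modulus_atTop : Tendsto modulus atTop (𝓝 0) := by
  have hexp (p : ℝ) (hp : 0 < p) : Tendsto (fun t => rexp (-p * t)) atTop (𝓝 0) :=
    Real.tendsto_exp_atBot.comp (tendsto_id.const_mul_atTop_of_neg (neg_lt_zero.mpr hp))
  have heven : Tendsto (HurwitzZeta.evenKernel (1 / 2 : ℝ)) atTop (𝓝 0) := by
    obtain ⟨p, hp, hO⟩ := HurwitzZeta.isBigO_atTop_evenKernel_sub (1 / 2 : ℝ)
    have hhalf : ((1 / 2 : ℝ) : UnitAddCircle) ≠ 0 :=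
      mt (AddCircle.coe_eq_zero_iff_of_mem_Ico (by norm_num)).mp (by norm_num)
    simpa only [if_neg hhalf, sub_zero] using hO.trans_tendsto (hexp p hp)
  have hcos : Tendsto (HurwitzZeta.cosKernel 0) atTop (𝓝 1) := by
    obtain ⟨p, hp, hO⟩ := HurwitzZeta.isBigO_atTop_cosKernel_sub 0
    exact tendsto_sub_nhds_zero_iff.mp (hO.trans_tendsto (hexp p hp))
  rw [show (0 : ℝ) = (0 / 1) ^ 2 by norm_num]
  exact (heven.div hcos one_ne_zero).pow 2

lemma continuousOn_modulus : ContinuousOn modulus (Ioi 0) :=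
  ((HurwitzZeta.continuousOn_evenKernel _).div (HurwitzZeta.continuousOn_cosKernel _)
    fun _ ht => (cosKernel_pos _ ht).ne').pow 2

lemma tendsto_modulus_zero : Tendsto modulus (𝓝[>] 0) (𝓝 1) := by
  have hcompl : Tendsto compl (𝓝 0) (𝓝 1) :=
    Continuous.tendsto' (by unfold compl; fun_prop) 0 1 (by simp [compl])
  refine (hcompl.comp (tendsto_modulus_atTop.comp tendsto_inv_nhdsGT_zero)).congr' ?_
  filter_upwards [self_mem_nhdsWithin] with t ht
  simp only [Function.comp_apply, compl_modulus (inv_pos.mpr (mem_Ioi.mp ht)), inv_inv]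

lemma exists_modulus_eq {k : ℝ} (hk : k ∈ Ioo 0 1) : ∃ t : ℝ, 0 < t ∧ modulus t = k :=
  isPreconnected_Ioi.intermediate_value_Ioo (le_principal_iff.mpr (Ioi_mem_atTop 0))
    (le_principal_iff.mpr self_mem_nhdsWithin) continuousOn_modulus tendsto_modulus_atTop
    tendsto_modulus_zero hk

/-! ### The Jacobi elliptic functions of the lattice with period ratio `it` -/

/-- The Jacobi function `sn` of modulus `modulus t`, as a theta quotient. In `thetaSn`, `thetaCn`
and `thetaDn` the argument is scaled so that `K = 1/2`. -/
def thetaSn (t : ℝ) (z : ℂ) : ℂ :=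
  vartheta₃ (I * t) 0 / vartheta₂ (I * t) 0 * (vartheta₁ (I * t) z / vartheta₄ (I * t) z)

/-- The Jacobi function `cn` of modulus `modulus t`, as a theta quotient. -/
def thetaCn (t : ℝ) (z : ℂ) : ℂ :=
  vartheta₄ (I * t) 0 / vartheta₂ (I * t) 0 * (vartheta₂ (I * t) z / vartheta₄ (I * t) z)

/-- The Jacobi function `dn` of modulus `modulus t`, as a theta quotient. -/
def thetaDn (t : ℝ) (z : ℂ) : ℂ :=
  vartheta₄ (I * t) 0 / vartheta₃ (I * t) 0 * (vartheta₃ (I * t) z / vartheta₄ (I * t) z)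

lemma thetaSn_zero (t : ℝ) : thetaSn t 0 = 0 := by
  rw [thetaSn, vartheta₁_zero, zero_div, mul_zero]

lemma thetaSn_conj (t : ℝ) (z : ℂ) : conj (thetaSn t z) = thetaSn t (conj z) := by
  simp only [thetaSn, map_mul, map_div₀, vartheta₁_conj, vartheta₂_conj, vartheta₃_conj,
    vartheta₄_conj, map_zero]

section RealValues

variable (t u : ℝ)

lemma ofReal_re_thetaSn : ((thetaSn t u).re : ℂ) = thetaSn t u :=
  conj_eq_iff_re.mp (by rw [thetaSn_conj, conj_ofReal])

lemma ofReal_re_deriv_thetaSn_zero : ((deriv (thetaSn t) 0).re : ℂ) = deriv (thetaSn t) 0 := by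
  have hconj : conj ∘ thetaSn t ∘ conj = thetaSn t :=
    funext fun z => by rw [Function.comp_apply, Function.comp_apply, thetaSn_conj, conj_conj]
  have h := congrFun (deriv_conj_conj (f := thetaSn t)) 0
  rw [hconj, Function.comp_apply, Function.comp_apply, map_zero] at h
  exact conj_eq_iff_re.mp h.symm

lemma ofReal_re_thetaCn : ((thetaCn t u).re : ℂ) = thetaCn t u :=
  conj_eq_iff_re.mp <| by
    simp only [thetaCn, map_mul, map_div₀, vartheta₂_conj, vartheta₄_conj, map_zero, conj_ofReal]

lemma ofReal_re_thetaDn : ((thetaDn t u).re : ℂ) = thetaDn t u :=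
  conj_eq_iff_re.mp <| by
    simp only [thetaDn, map_mul, map_div₀, vartheta₃_conj, vartheta₄_conj, map_zero, conj_ofReal]

end RealValues

section JacobiFunctions

variable {t : ℝ} (ht : 0 < t)
include ht

lemma thetaSn_half : thetaSn t (1 / 2) = 1 := by
  have h₂ := (vartheta₂_zero_pos ht).ne'
  have h₃ := (vartheta₃_zero_pos ht).ne'
  rw [← zero_add (1 / 2), thetaSn, vartheta₁_add_half, vartheta₄_add_half]
  field_simp

lemma thetaCn_zero : thetaCn t 0 = 1 := by
  have h₂ := (vartheta₂_zero_pos ht).ne'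
  have h₄ := (vartheta₄_zero_pos ht).ne'
  rw [thetaCn]
  field_simp

lemma thetaCn_ofReal_pos {u : ℝ} (hu : u ∈ Ico 0 (1 / 2)) : 0 < thetaCn t u :=
  mul_pos (div_pos (vartheta₄_zero_pos ht) (vartheta₂_zero_pos ht))
    (div_pos (vartheta₂_ofReal_pos ht hu) (vartheta₄_ofReal_pos ht u))

lemma thetaDn_ofReal_pos (u : ℝ) : 0 < thetaDn t u :=
  mul_pos (div_pos (vartheta₄_zero_pos ht) (vartheta₃_zero_pos ht))
    (div_pos (vartheta₃_ofReal_pos ht u) (vartheta₄_ofReal_pos ht u))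

variable {z : ℂ} (hz : vartheta₄ (I * t) z ≠ 0)

section
include hz

lemma thetaSn_sq_add_thetaCn_sq : thetaSn t z ^ 2 + thetaCn t z ^ 2 = 1 := by
  have h := vartheta₁_sq_add_vartheta₂_sq (im_I_mul_ofReal_pos ht) z
  have h₂ := (vartheta₂_zero_pos ht).ne'
  rw [thetaSn, thetaCn]
  field_simp
  linear_combination h

lemma thetaDn_sq : thetaDn t z ^ 2 = 1 - (modulus t : ℂ) ^ 2 * thetaSn t z ^ 2 := by
  have h := vartheta₁_sq_add_vartheta₃_sq (im_I_mul_ofReal_pos ht) z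
  have h₃ := (vartheta₃_zero_pos ht).ne'
  rw [ofReal_modulus, thetaDn, thetaSn]
  field_simp
  linear_combination h

lemma differentiableAt_thetaCn : DifferentiableAt ℂ (thetaCn t) z :=
  ((differentiable_vartheta₂ (im_I_mul_ofReal_pos ht) z).div
    (differentiable_vartheta₄ (im_I_mul_ofReal_pos ht) z) hz).const_mul _

lemma hasDerivAt_thetaSn :
    HasDerivAt (thetaSn t) (deriv (thetaSn t) 0 * thetaCn t z * thetaDn t z) z := by
  have hτ := im_I_mul_ofReal_pos ht
  have h₂ := (vartheta₂_zero_pos ht).ne'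
  have h₃ := (vartheta₃_zero_pos ht).ne'
  have h₄ := (vartheta₄_zero_pos ht).ne'
  have hquot {w : ℂ} (hw : vartheta₄ (I * t) w ≠ 0) :=
    ((differentiable_vartheta₁ hτ w).hasDerivAt.div (differentiable_vartheta₄ hτ w).hasDerivAt
      hw).const_mul (vartheta₃ (I * t) 0 / vartheta₂ (I * t) 0)
  refine (hquot hz).congr_deriv ?_
  change _ = deriv (fun w => _ * (vartheta₁ (I * t) / vartheta₄ (I * t)) w) 0 * _ * _
  rw [(hquot h₄).deriv, vartheta₁_zero, thetaCn, thetaDn]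
  field_simp
  linear_combination wronskian_vartheta₁_vartheta₄ hτ z

end

lemma thetaSn_mul_left (u : ℝ) :
    thetaSn t (I * t * u) = I * (thetaSn t⁻¹ u / thetaCn t⁻¹ u) := by
  have hτ : I * (t : ℂ) ≠ 0 := mul_ne_zero I_ne_zero (ofReal_ne_zero.mpr ht.ne')
  have ht' : 0 < t⁻¹ := inv_pos.mpr ht
  have h₂ := (vartheta₂_zero_pos ht').ne'
  have h₄ := (vartheta₄_ofReal_pos ht' u).ne'
  have hzero := modularFactor_ne_zero hτ 0
  have hu := modularFactor_ne_zero hτ u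
  have hθ₂ := vartheta₂_mul_left hτ 0
  have hθ₃ := vartheta₃_mul_left hτ 0
  rw [mul_zero] at hθ₂ hθ₃
  rw [thetaSn, hθ₂, hθ₃, vartheta₁_mul_left hτ, vartheta₄_mul_left hτ, neg_one_div_I_mul_ofReal,
    thetaSn, thetaCn]
  generalize t⁻¹ = s at h₂ h₄ ⊢
  field_simp

lemma thetaCn_mul_left_add_half (u : ℝ) :
    thetaCn t (I * t * u + 1 / 2) = -I * modulus t⁻¹ * (thetaSn t⁻¹ u / thetaDn t⁻¹ u) := by
  have hτ : I * (t : ℂ) ≠ 0 := mul_ne_zero I_ne_zero (ofReal_ne_zero.mpr ht.ne')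
  have ht' : 0 < t⁻¹ := inv_pos.mpr ht
  have h₂ := (vartheta₂_zero_pos ht').ne'
  have h₃ := (vartheta₃_zero_pos ht').ne'
  have h₄ := (vartheta₄_ofReal_pos ht' u).ne'
  have hzero := modularFactor_ne_zero hτ 0
  have hu := modularFactor_ne_zero hτ u
  have hθ₂ := vartheta₂_mul_left hτ 0
  have hθ₄ := vartheta₄_mul_left hτ 0
  rw [mul_zero] at hθ₂ hθ₄
  rw [thetaCn, hθ₂, hθ₄, vartheta₂_add_half, vartheta₄_add_half, vartheta₁_mul_left hτ,
    vartheta₃_mul_left hτ, neg_one_div_I_mul_ofReal, ofReal_modulus, thetaSn, thetaDn]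
  generalize t⁻¹ = s at h₂ h₃ h₄ ⊢
  field_simp

lemma deriv_thetaSn_inv_zero : deriv (thetaSn t⁻¹) 0 = t * deriv (thetaSn t) 0 := by
  have ht' : 0 < t⁻¹ := inv_pos.mpr ht
  have h₄ := (vartheta₄_zero_pos ht').ne'
  have hleft : HasDerivAt (fun u : ℝ => thetaSn t (I * t * u))
      (deriv (thetaSn t) 0 * (I * t)) 0 := by
    have hline : HasDerivAt (fun w : ℂ => I * t * w) (I * t) (0 : ℝ) := by
      simpa only [mul_one] using hasDerivAt_const_mul (I * (t : ℂ))
    have hsn : HasDerivAt (thetaSn t) (deriv (thetaSn t) 0) (I * t * (0 : ℝ)) := by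
      rw [ofReal_zero, mul_zero]
      exact (hasDerivAt_thetaSn ht (vartheta₄_zero_pos ht).ne').differentiableAt.hasDerivAt
    exact (hsn.comp _ hline).comp_ofReal
  have hright : HasDerivAt (fun u : ℝ => I * (thetaSn t⁻¹ u / thetaCn t⁻¹ u))
      (I * deriv (thetaSn t⁻¹) 0) 0 := by
    have hsn := (hasDerivAt_thetaSn ht' h₄).differentiableAt.hasDerivAt
    have hcn := (differentiableAt_thetaCn ht' h₄).hasDerivAt
    have hcn₀ : thetaCn t⁻¹ 0 ≠ 0 := by rw [thetaCn_zero ht']; exact one_ne_zero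
    have h := (((hsn.div hcn hcn₀).const_mul I).congr_deriv (g' := I * deriv (thetaSn t⁻¹) 0)
      (by rw [thetaCn_zero ht', thetaSn_zero]; ring))
    exact HasDerivAt.comp_ofReal (z := 0) (by rwa [ofReal_zero])
  have h := hleft.unique (hright.congr_of_eventuallyEq (.of_forall (thetaSn_mul_left ht)))
  exact mul_left_cancel₀ I_ne_zero (by linear_combination -h)

lemma thetaCn_add_half_add_half_period :
    thetaCn t (z + 1 / 2 + I * t / 2) = -I * (modulus t⁻¹ / modulus t) / thetaCn t z := by
  have h₂ := (vartheta₂_zero_pos ht).ne'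
  have h₃ := (vartheta₃_zero_pos ht).ne'
  have h₄ := (vartheta₄_zero_pos ht).ne'
  rw [thetaCn, ← mul_div_mul_left (vartheta₂ _ _) _ (halfPeriodFactor_ne_zero (I * t) z),
    vartheta₂_add_half_add_half_period, vartheta₄_add_half_add_half_period,
    ofReal_modulus_inv ht, ofReal_modulus, thetaCn]
  field_simp

end JacobiFunctions

/-! ### Inversion of the elliptic integral -/

section EllipticIntegral

variable {k : ℝ} (hk : k ^ 2 < 1)
include hk

lemma one_sub_mul_sin_sq_pos (φ : ℝ) : 0 < 1 - k ^ 2 * Real.sin φ ^ 2 := by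
  nlinarith [Real.sin_sq_le_one φ, sq_nonneg (Real.sin φ), sq_nonneg k]

lemma continuous_ellipticF_integrand :
    Continuous fun φ : ℝ => 1 / √(1 - k ^ 2 * Real.sin φ ^ 2) :=
  continuous_const.div (by fun_prop) fun φ => (Real.sqrt_pos.mpr (one_sub_mul_sin_sq_pos hk φ)).ne'

lemma hasDerivAt_ellipticF (φ : ℝ) :
    HasDerivAt (ellipticF · k) (1 / √(1 - k ^ 2 * Real.sin φ ^ 2)) φ :=
  ((continuous_ellipticF_integrand hk).integral_hasStrictDerivAt 0 φ).hasDerivAt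

lemma ellipticK_pos : 0 < ellipticK k :=
  intervalIntegral.intervalIntegral_pos_of_pos
    ((continuous_ellipticF_integrand hk).intervalIntegrable _ _)
    (fun φ => one_div_pos.mpr (Real.sqrt_pos.mpr (one_sub_mul_sin_sq_pos hk φ)))
    (half_pos Real.pi_pos)

lemma hasDerivAt_ellipticF_arcsin {S : ℝ → ℝ} {c C D x : ℝ} (hS : HasDerivAt S (c * C * D) x)
    (hSC : S x ^ 2 + C ^ 2 = 1) (hSD : D ^ 2 = 1 - k ^ 2 * S x ^ 2) (hC : 0 < C) (hD : 0 < D) :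
    HasDerivAt (fun y => ellipticF (Real.arcsin (S y)) k) c x := by
  have hlt : S x < 1 := by nlinarith
  have hgt : -1 < S x := by nlinarith
  have harcsin := (Real.hasDerivAt_arcsin hgt.ne' hlt.ne).comp x hS
  have hF := (hasDerivAt_ellipticF hk (Real.arcsin (S x))).comp x harcsin
  refine hF.congr_deriv ?_
  rw [Real.sin_arcsin hgt.le hlt.le, ← hSD, Real.sqrt_sq hD.le,
    ← eq_sub_of_add_eq' hSC, Real.sqrt_sq hC.le]
  field_simp

/-- A function satisfying the differential equations of `sn(c ·, k)` inverts `F(·, k)`. -/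
lemma ellipticF_arcsin_eq_mul {S C D : ℝ → ℝ} {c b : ℝ} (hS₀ : S 0 = 0)
    (hS : ∀ x, HasDerivAt S (c * C x * D x) x) (hSC : ∀ x, S x ^ 2 + C x ^ 2 = 1)
    (hSD : ∀ x, D x ^ 2 = 1 - k ^ 2 * S x ^ 2) (hC : ∀ x ∈ Ico 0 b, 0 < C x)
    (hD : ∀ x, 0 < D x) {u : ℝ} (hu : u ∈ Icc 0 b) :
    ellipticF (Real.arcsin (S u)) k = c * u := by
  have hcont : Continuous S := continuous_iff_continuousAt.mpr fun x => (hS x).continuousAt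
  have hF : Continuous (ellipticF · k) :=
    continuous_iff_continuousAt.mpr fun φ => (hasDerivAt_ellipticF hk φ).continuousAt
  have hconst := constant_of_has_deriv_right_zero
    (f := fun x => ellipticF (Real.arcsin (S x)) k - c * x)
    ((hF.comp (Real.continuous_arcsin.comp hcont)).sub (continuous_const_mul c)).continuousOn
    (fun x hx => by
      have hx' := (hasDerivAt_ellipticF_arcsin hk (hS x) (hSC x) (hSD x) (hC x hx) (hD x)).sub
        (hasDerivAt_const_mul c)
      exact (hx'.congr_deriv (sub_self c)).hasDerivWithinAt) u hu
  have hF₀ : ellipticF 0 k = 0 := intervalIntegral.integral_same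
  rw [hS₀, Real.arcsin_zero, hF₀, mul_zero, sub_zero] at hconst
  exact sub_eq_zero.mp hconst

end EllipticIntegral

section Inversion

variable {t : ℝ} (ht : 0 < t)
include ht

lemma hasDerivAt_re_thetaSn (u : ℝ) :
    HasDerivAt (fun x : ℝ => (thetaSn t x).re)
      ((deriv (thetaSn t) 0).re * (thetaCn t u).re * (thetaDn t u).re) u := by
  refine (hasDerivAt_thetaSn ht (vartheta₄_ofReal_pos ht u).ne').real_of_complex.congr_deriv ?_
  rw [← ofReal_re_deriv_thetaSn_zero, ← ofReal_re_thetaCn, ← ofReal_re_thetaDn, ← ofReal_mul,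
    ← ofReal_mul, ofReal_re, ofReal_re, ofReal_re, ofReal_re]

lemma ellipticF_arcsin_thetaSn {u : ℝ} (hu : u ∈ Icc 0 (1 / 2)) :
    ellipticF (Real.arcsin (thetaSn t u).re) (modulus t) = (deriv (thetaSn t) 0).re * u := by
  refine ellipticF_arcsin_eq_mul (modulus_sq_lt_one ht) (S := fun x => (thetaSn t x).re) ?_
    (hasDerivAt_re_thetaSn ht) (fun x => ?_) (fun x => ?_)
    (fun x hx => (Complex.pos_iff.mp (thetaCn_ofReal_pos ht hx)).1)
    (fun x => (Complex.pos_iff.mp (thetaDn_ofReal_pos ht x)).1) hu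
  · rw [ofReal_zero, thetaSn_zero, zero_re]
  · have h := thetaSn_sq_add_thetaCn_sq ht (vartheta₄_ofReal_pos ht x).ne'
    rw [← ofReal_re_thetaSn, ← ofReal_re_thetaCn] at h
    exact_mod_cast h
  · have h := thetaDn_sq ht (vartheta₄_ofReal_pos ht x).ne'
    rw [← ofReal_re_thetaSn, ← ofReal_re_thetaDn] at h
    exact_mod_cast h

lemma re_deriv_thetaSn_zero : (deriv (thetaSn t) 0).re = 2 * ellipticK (modulus t) := by
  have h := ellipticF_arcsin_thetaSn ht (right_mem_Icc.mpr one_half_pos.le)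
  push_cast at h
  rw [thetaSn_half ht, one_re, Real.arcsin_one] at h
  rw [ellipticK, h]
  ring

lemma ellipticK'_modulus : ellipticK' (modulus t) = t * ellipticK (modulus t) := by
  have h := congrArg re (deriv_thetaSn_inv_zero ht)
  rw [re_ofReal_mul, re_deriv_thetaSn_zero ht, re_deriv_thetaSn_zero (inv_pos.mpr ht)] at h
  rw [ellipticK', compl_modulus ht]
  linarith

lemma nome_modulus : nome (modulus t) = rexp (-(π * t)) := by
  rw [nome, ellipticK'_modulus ht, ← mul_assoc,
    mul_div_cancel_right₀ _ (ellipticK_pos (modulus_sq_lt_one ht)).ne']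

lemma exists_thetaSn_sq_eq {x : ℝ} (hx : x ∈ Icc 0 1) :
    ∃ u ∈ Icc (0 : ℝ) (1 / 2), thetaSn t u ^ 2 = x ∧
      ellipticF (Real.arcsin √x) (modulus t) = 2 * ellipticK (modulus t) * u := by
  have hcont : Continuous fun y : ℝ => (thetaSn t y).re :=
    continuous_iff_continuousAt.mpr fun y => (hasDerivAt_re_thetaSn ht y).continuousAt
  have hzero : (thetaSn t (0 : ℝ)).re = 0 := by rw [ofReal_zero, thetaSn_zero, zero_re]
  have hhalf : (thetaSn t (1 / 2 : ℝ)).re = 1 := by push_cast; rw [thetaSn_half ht, one_re]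
  have hsqrt : √x ∈ Icc (thetaSn t (0 : ℝ)).re (thetaSn t (1 / 2 : ℝ)).re := by
    rw [hzero, hhalf]
    exact ⟨Real.sqrt_nonneg x, Real.sqrt_le_one.mpr hx.2⟩
  obtain ⟨u, hu, hsn : (thetaSn t u).re = √x⟩ :=
    intermediate_value_Icc one_half_pos.le hcont.continuousOn hsqrt
  refine ⟨u, hu, ?_, ?_⟩
  · rw [← ofReal_re_thetaSn, hsn, ← ofReal_pow, Real.sq_sqrt hx.1]
  · rw [← hsn, ellipticF_arcsin_thetaSn ht hu, re_deriv_thetaSn_zero ht]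

end Inversion

/-! ### The frequency as an elliptic function -/

section Series

variable {t : ℝ} (ht : 0 < t) (z : ℂ)

lemma ofReal_exp_neg_pi_mul_rpow (t r : ℝ) :
    ((rexp (-(π * t)) ^ r : ℝ) : ℂ) = cexp (π * I * (I * t) * r) := by
  rw [← Real.exp_mul, ofReal_exp]
  push_cast
  congr 1
  linear_combination -(π * t * r : ℂ) * I_sq

include ht

lemma theta1_exp : theta1 (rexp (-(π * t))) (π * z) = vartheta₁ (I * t) z := by
  rw [← (hasSum_vartheta₁ (im_I_mul_ofReal_pos ht) z).tsum_eq, theta1, tsum_mul_left]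
  simp only [ofReal_exp_neg_pi_mul_rpow]
  push_cast
  rfl

lemma theta2_exp : theta2 (rexp (-(π * t))) (π * z) = vartheta₂ (I * t) z := by
  rw [← (hasSum_vartheta₂ (im_I_mul_ofReal_pos ht) z).tsum_eq, theta2, tsum_mul_left]
  simp only [ofReal_exp_neg_pi_mul_rpow]
  push_cast
  rfl

lemma theta4_exp : theta4 (rexp (-(π * t))) (π * z) = vartheta₄ (I * t) z := by
  rw [← add_sub_cancel 1 (vartheta₄ _ z), ← (hasSum_vartheta₄ (im_I_mul_ofReal_pos ht) z).tsum_eq,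
    theta4, tsum_mul_left]
  simp only [← Real.rpow_natCast, ofReal_exp_neg_pi_mul_rpow]
  push_cast
  rfl

end Series

/-- The cubic in `λ` that equals `ω(α)²` on the solutions of the characteristic equation. -/
def frequencyCubic (k lam : ℝ) : ℝ :=
  16 * (1 - k ^ 2 - lam) * (lam - 1 + 2 * k ^ 2) * (lam + k ^ 2)

section Modulus

variable {t : ℝ} (ht : 0 < t)

lemma scaledArg_eq (k : ℝ) (x : ℂ) : scaledArg k x = π * (x / (2 * ellipticK k)) :=
  mul_div_assoc _ _ _

include ht

lemma jacobiH_modulus (x : ℂ) :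
    jacobiH (modulus t) x = vartheta₁ (I * t) (x / (2 * ellipticK (modulus t))) := by
  rw [jacobiH, nome_modulus ht, scaledArg_eq, theta1_exp ht]

lemma jacobiTheta_modulus (x : ℂ) :
    jacobiTheta (modulus t) x = vartheta₄ (I * t) (x / (2 * ellipticK (modulus t))) := by
  rw [jacobiTheta, nome_modulus ht, scaledArg_eq, theta4_exp ht]

lemma jacobiCn_modulus (x : ℂ) :
    jacobiCn (modulus t) x = thetaCn t (x / (2 * ellipticK (modulus t))) := by
  rw [jacobiCn, nome_modulus ht, scaledArg_eq, theta4_exp ht, theta2_exp ht,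
    ← mul_zero (π : ℂ), theta4_exp ht, theta2_exp ht, thetaCn]

lemma differentiable_jacobiH : Differentiable ℂ (jacobiH (modulus t)) := by
  rw [funext (jacobiH_modulus ht)]
  exact (differentiable_vartheta₁ (im_I_mul_ofReal_pos ht)).comp (differentiable_id.div_const _)

lemma differentiable_jacobiTheta : Differentiable ℂ (jacobiTheta (modulus t)) := by
  rw [funext (jacobiTheta_modulus ht)]
  exact (differentiable_vartheta₄ (im_I_mul_ofReal_pos ht)).comp (differentiable_id.div_const _)

lemma ofReal_ellipticK_modulus_ne_zero : (ellipticK (modulus t) : ℂ) ≠ 0 :=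
  ofReal_ne_zero.mpr (ellipticK_pos (modulus_sq_lt_one ht)).ne'

lemma thetaSn_div_two_mul_ellipticK (x : ℂ) :
    thetaSn t (x / (2 * ellipticK (modulus t))) =
      vartheta₃ (I * t) 0 / vartheta₂ (I * t) 0 *
        (jacobiH (modulus t) x / jacobiTheta (modulus t) x) := by
  rw [thetaSn, jacobiH_modulus ht, jacobiTheta_modulus ht]

lemma logDeriv_jacobiH_sub_logDeriv_jacobiTheta {x : ℂ} (hH : jacobiH (modulus t) x ≠ 0)
    (hΘ : jacobiTheta (modulus t) x ≠ 0) :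
    logDeriv (jacobiH (modulus t)) x - logDeriv (jacobiTheta (modulus t)) x =
      thetaCn t (x / (2 * ellipticK (modulus t))) * thetaDn t (x / (2 * ellipticK (modulus t))) /
        thetaSn t (x / (2 * ellipticK (modulus t))) := by
  have hK := ofReal_ellipticK_modulus_ne_zero ht
  have hconst : vartheta₃ (I * t) 0 / vartheta₂ (I * t) 0 ≠ 0 :=
    div_ne_zero (vartheta₃_zero_pos ht).ne' (vartheta₂_zero_pos ht).ne'
  have hscale : deriv (thetaSn t) 0 = 2 * ellipticK (modulus t) := by
    rw [← ofReal_re_deriv_thetaSn_zero, re_deriv_thetaSn_zero ht]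
    push_cast
    rfl
  have hsn : HasDerivAt (fun y => thetaSn t (y / (2 * ellipticK (modulus t))))
      (thetaCn t (x / (2 * ellipticK (modulus t))) *
        thetaDn t (x / (2 * ellipticK (modulus t)))) x := by
    refine ((hasDerivAt_thetaSn ht (jacobiTheta_modulus ht x ▸ hΘ)).comp x
      ((hasDerivAt_id x).div_const _)).congr_deriv ?_
    rw [hscale, id_eq]
    field_simp
  rw [← logDeriv_div x hH hΘ (differentiable_jacobiH ht x) (differentiable_jacobiTheta ht x),
    ← logDeriv_const_mul x _ hconst,
    ← funext (thetaSn_div_two_mul_ellipticK ht), logDeriv_apply, hsn.deriv]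

section CharacteristicEq

variable {lam : ℝ} {α : ℂ}

lemma characteristicEq_modulus_iff : CharacteristicEq (modulus t) lam α ↔
    vartheta₄ (I * t) (α / (2 * ellipticK (modulus t))) ≠ 0 ∧
      (lam : ℂ) = 1 - 2 * (modulus t : ℂ) ^ 2 +
        (modulus t : ℂ) ^ 2 * thetaCn t (α / (2 * ellipticK (modulus t))) ^ 2 := by
  rw [CharacteristicEq, jacobiTheta_modulus ht, jacobiCn_modulus ht]

variable (h : CharacteristicEq (modulus t) lam α)
include h

lemma CharacteristicEq.modulus_sq_mul_thetaCn_sq :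
    (modulus t : ℂ) ^ 2 * thetaCn t (α / (2 * ellipticK (modulus t))) ^ 2 =
      lam - 1 + 2 * (modulus t : ℂ) ^ 2 := by
  linear_combination -((characteristicEq_modulus_iff ht).mp h).2

lemma CharacteristicEq.modulus_sq_mul_thetaSn_sq :
    (modulus t : ℂ) ^ 2 * thetaSn t (α / (2 * ellipticK (modulus t))) ^ 2 =
      1 - (modulus t : ℂ) ^ 2 - lam := by
  obtain ⟨hΘ, hlam⟩ := (characteristicEq_modulus_iff ht).mp h
  linear_combination (modulus t : ℂ) ^ 2 * thetaSn_sq_add_thetaCn_sq ht hΘ + hlam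

lemma CharacteristicEq.thetaDn_sq :
    thetaDn t (α / (2 * ellipticK (modulus t))) ^ 2 = lam + (modulus t : ℂ) ^ 2 := by
  rw [LameKdV.thetaDn_sq ht ((characteristicEq_modulus_iff ht).mp h).1,
    h.modulus_sq_mul_thetaSn_sq ht]
  ring

variable (hlam : lam ≠ 1 - modulus t ^ 2)
include hlam

lemma CharacteristicEq.thetaSn_ne_zero :
    thetaSn t (α / (2 * ellipticK (modulus t))) ≠ 0 := by
  intro hsn
  have h' := h.modulus_sq_mul_thetaSn_sq ht
  rw [hsn, zero_pow two_ne_zero, mul_zero] at h'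
  norm_cast at h'
  exact hlam (by linarith)

lemma CharacteristicEq.jacobiH_ne_zero : jacobiH (modulus t) α ≠ 0 := by
  intro hH
  apply h.thetaSn_ne_zero ht hlam
  rw [thetaSn_div_two_mul_ellipticK ht, hH, zero_div, mul_zero]

lemma CharacteristicEq.omega_eq : omega (modulus t) lam α =
    4 * (modulus t : ℂ) ^ 2 * thetaSn t (α / (2 * ellipticK (modulus t))) *
      thetaCn t (α / (2 * ellipticK (modulus t))) *
        thetaDn t (α / (2 * ellipticK (modulus t))) := by
  have hsn := h.thetaSn_ne_zero ht hlam
  have hlog := logDeriv_jacobiH_sub_logDeriv_jacobiTheta ht (h.jacobiH_ne_zero ht hlam) h.1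
  rw [logDeriv_apply, logDeriv_apply, ← neg_inj, neg_sub] at hlog
  rw [omega, hlog, show (lam : ℂ) + (modulus t : ℂ) ^ 2 - 1 =
    -((modulus t : ℂ) ^ 2 * thetaSn t (α / (2 * ellipticK (modulus t))) ^ 2) by
      rw [h.modulus_sq_mul_thetaSn_sq ht]; ring]
  field_simp

lemma CharacteristicEq.omega_sq :
    omega (modulus t) lam α ^ 2 = frequencyCubic (modulus t) lam := by
  rw [h.omega_eq ht hlam, frequencyCubic]
  push_cast
  rw [← h.modulus_sq_mul_thetaSn_sq ht, ← h.modulus_sq_mul_thetaCn_sq ht, ← h.thetaDn_sq ht]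
  ring

end CharacteristicEq

end Modulus

/-! ### The explicit parameter `α` -/

section PathAlpha

variable {t : ℝ} (ht : 0 < t)
include ht

lemma ofReal_modulus_inv_sq : (modulus t⁻¹ : ℂ) ^ 2 = 1 - (modulus t : ℂ) ^ 2 := by
  rw [eq_sub_iff_add_eq']
  exact_mod_cast modulus_sq_add_modulus_inv_sq ht

variable {x : ℝ}

lemma characteristicEq_ellipticF (hx : x ∈ Icc 0 1) :
    CharacteristicEq (modulus t) (1 - modulus t ^ 2 - modulus t ^ 2 * x)
      (ellipticF (Real.arcsin √x) (modulus t)) := by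
  obtain ⟨u, -, hsn, hF⟩ := exists_thetaSn_sq_eq ht hx
  have hΘ := (vartheta₄_ofReal_pos ht u).ne'
  have harg : (ellipticF (Real.arcsin √x) (modulus t) : ℂ) / (2 * ellipticK (modulus t)) = u := by
    have hK := ofReal_ellipticK_modulus_ne_zero ht
    rw [hF]
    push_cast
    field_simp
  rw [characteristicEq_modulus_iff ht, harg]
  refine ⟨hΘ, ?_⟩
  push_cast
  linear_combination -(modulus t : ℂ) ^ 2 * (thetaSn_sq_add_thetaCn_sq ht hΘ - hsn)

lemma characteristicEq_ellipticK_add (hx : x ∈ Icc 0 1) :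
    CharacteristicEq (modulus t)
      (1 - 2 * modulus t ^ 2 -
        modulus t ^ 2 * ((1 - modulus t ^ 2) * x / (1 - (1 - modulus t ^ 2) * x)))
      (ellipticK (modulus t) + I * ellipticF (Real.arcsin √x) (compl (modulus t))) := by
  have ht' : 0 < t⁻¹ := inv_pos.mpr ht
  have hτ : I * (t : ℂ) ≠ 0 := mul_ne_zero I_ne_zero (ofReal_ne_zero.mpr ht.ne')
  obtain ⟨u, -, hsn, hF⟩ := exists_thetaSn_sq_eq ht' hx
  have harg : (ellipticK (modulus t) + I * ellipticF (Real.arcsin √x) (compl (modulus t)) : ℂ) /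
      (2 * ellipticK (modulus t)) = I * t * u + 1 / 2 := by
    have hK := ofReal_ellipticK_modulus_ne_zero ht
    rw [compl_modulus ht, hF, ← compl_modulus ht, ← ellipticK', ellipticK'_modulus ht]
    push_cast
    field_simp
    ring
  rw [characteristicEq_modulus_iff ht, harg]
  constructor
  · rw [vartheta₄_add_half, vartheta₃_mul_left hτ, neg_one_div_I_mul_ofReal]
    exact mul_ne_zero (modularFactor_ne_zero hτ u) (vartheta₃_ofReal_pos ht' u).ne'
  · have hcn : thetaCn t (I * t * u + 1 / 2) ^ 2 =
        -((1 - (modulus t : ℂ) ^ 2) * x / (1 - (1 - (modulus t : ℂ) ^ 2) * x)) := by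
      rw [thetaCn_mul_left_add_half ht, mul_pow, mul_pow, div_pow, neg_sq, I_sq,
        thetaDn_sq ht' (vartheta₄_ofReal_pos ht' u).ne', hsn, ofReal_modulus_inv_sq ht]
      ring
    rw [hcn]
    push_cast
    ring

lemma characteristicEq_ellipticK_add_ellipticK'_add (hx : x ∈ Ico 0 1) :
    CharacteristicEq (modulus t)
      (1 - 2 * modulus t ^ 2 - (1 - modulus t ^ 2) / (1 - x))
      (ellipticK (modulus t) + I * ellipticK' (modulus t) +
        ellipticF (Real.arcsin √x) (modulus t)) := by
  obtain ⟨u, hu, hsn, hF⟩ := exists_thetaSn_sq_eq ht (Ico_subset_Icc_self hx)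
  have hu' : u ≠ 1 / 2 := by
    rintro rfl
    push_cast at hsn
    rw [thetaSn_half ht, one_pow] at hsn
    exact hx.2.ne' (by exact_mod_cast hsn)
  have hθ₂ := (vartheta₂_ofReal_pos ht ⟨hu.1, hu.2.lt_of_ne hu'⟩).ne'
  have harg : (ellipticK (modulus t) + I * ellipticK' (modulus t) +
      ellipticF (Real.arcsin √x) (modulus t) : ℂ) / (2 * ellipticK (modulus t)) =
      u + 1 / 2 + I * t / 2 := by
    have hK := ofReal_ellipticK_modulus_ne_zero ht
    rw [hF, ellipticK'_modulus ht]
    push_cast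
    field_simp
    ring
  rw [characteristicEq_modulus_iff ht, harg]
  constructor
  · rw [← vartheta₄_add_half_add_half_period] at hθ₂
    exact right_ne_zero_of_mul hθ₂
  · have hk : (modulus t : ℂ) ≠ 0 := ofReal_ne_zero.mpr (modulus_pos ht).ne'
    have hcn : thetaCn t u ^ 2 = 1 - x := by
      linear_combination thetaSn_sq_add_thetaCn_sq ht (vartheta₄_ofReal_pos ht u).ne' - hsn
    have hshift : (modulus t : ℂ) ^ 2 * thetaCn t (u + 1 / 2 + I * t / 2) ^ 2 =
        -((1 - (modulus t : ℂ) ^ 2) / (1 - x)) := by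
      rw [thetaCn_add_half_add_half_period ht, div_pow, hcn, mul_pow, neg_sq, I_sq, div_pow,
        ofReal_modulus_inv_sq ht]
      field_simp
    rw [hshift]
    push_cast
    ring

variable {lam : ℝ}

lemma characteristicEq_pathAlpha (h : lam ≤ 1 - modulus t ^ 2) :
    CharacteristicEq (modulus t) lam (pathAlpha (modulus t) lam) := by
  have hk := pow_pos (modulus_pos ht) 2
  have hk' := modulus_sq_lt_one ht
  unfold pathAlpha
  split_ifs with h₁ h₂
  · have hx : (1 - modulus t ^ 2 - lam) / modulus t ^ 2 ∈ Icc (0 : ℝ) 1 :=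
      ⟨div_nonneg (by linarith) hk.le, div_le_one_of_le₀ (by linarith) hk.le⟩
    have hα := characteristicEq_ellipticF ht hx
    rwa [Real.sqrt_div' _ hk.le, Real.sqrt_sq (modulus_pos ht).le, mul_div_cancel₀ _ hk.ne',
      sub_sub_cancel] at hα
  · have hd : 0 < 1 - modulus t ^ 2 - lam := by linarith
    have hden : 0 < (1 - modulus t ^ 2) * (1 - modulus t ^ 2 - lam) := mul_pos (by linarith) hd
    have hx : (1 - 2 * modulus t ^ 2 - lam) / ((1 - modulus t ^ 2) * (1 - modulus t ^ 2 - lam)) ∈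
        Icc (0 : ℝ) 1 :=
      ⟨div_nonneg (by linarith) hden.le, div_le_one_of_le₀ (by nlinarith) hden.le⟩
    have hα := characteristicEq_ellipticK_add ht hx
    have hsub : 1 - (1 - 2 * modulus t ^ 2 - lam) / (1 - modulus t ^ 2 - lam) =
        modulus t ^ 2 / (1 - modulus t ^ 2 - lam) := by
      rw [one_sub_div hd.ne']
      ring
    rwa [← mul_div_assoc (1 - modulus t ^ 2), mul_div_mul_left _ _ (sub_pos.mpr hk').ne', hsub,
      div_div_div_cancel_right₀ hd.ne', mul_div_cancel₀ _ hk.ne', sub_sub_cancel,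
      Real.sqrt_div' _ hden.le] at hα
  · have hd : 0 < 1 - 2 * modulus t ^ 2 - lam := by linarith
    have hx : (-modulus t ^ 2 - lam) / (1 - 2 * modulus t ^ 2 - lam) ∈ Ico (0 : ℝ) 1 :=
      ⟨div_nonneg (by linarith) hd.le, (div_lt_one hd).mpr (by linarith)⟩
    have hα := characteristicEq_ellipticK_add_ellipticK'_add ht hx
    have hsub : 1 - (-modulus t ^ 2 - lam) / (1 - 2 * modulus t ^ 2 - lam) =
        (1 - modulus t ^ 2) / (1 - 2 * modulus t ^ 2 - lam) := by
      rw [one_sub_div hd.ne']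
      ring
    rwa [hsub, div_div_cancel₀ (sub_pos.mpr hk').ne', sub_sub_cancel, Real.sqrt_div' _ hd.le] at hα

end PathAlpha

/-! ### Reality of the frequency -/

section Sign

variable {k lam : ℝ}

lemma frequencyCubic_nonneg (hk : k ^ 2 ≤ 1)
    (h : lam ∈ Iio (-k ^ 2) ∪ Ioo (1 - 2 * k ^ 2) (1 - k ^ 2)) :
    0 ≤ frequencyCubic k lam := by
  rcases h with h | ⟨h₁, h₂⟩
  · rw [mem_Iio] at h
    exact mul_nonneg_of_nonpos_of_nonpos
      (mul_nonpos_of_nonneg_of_nonpos (by linarith) (by linarith)) (by linarith)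
  · exact mul_nonneg (mul_nonneg (by linarith) (by linarith)) (by linarith)

lemma frequencyCubic_nonpos (h : lam ∈ Icc (-k ^ 2) (1 - 2 * k ^ 2)) :
    frequencyCubic k lam ≤ 0 :=
  mul_nonpos_of_nonpos_of_nonneg
    (mul_nonpos_of_nonneg_of_nonpos (by linarith [h.2, sq_nonneg k]) (by linarith [h.2]))
    (by linarith [h.1])

lemma exists_eq_ofReal_of_sq_eq {w : ℂ} {r : ℝ} (hw : w ^ 2 = r) (hr : 0 ≤ r) : ∃ x : ℝ, w = x := by
  have him : w.im = 0 := Complex.sq_nonneg_iff.mp (hw ▸ Complex.zero_le_real.mpr hr)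
  exact ⟨w.re, Complex.ext rfl him⟩

lemma exists_eq_I_mul_ofReal_of_sq_eq {w : ℂ} {r : ℝ} (hw : w ^ 2 = r) (hr : r ≤ 0) :
    ∃ x : ℝ, w = I * x := by
  have hre : w.re = 0 := Complex.sq_nonpos_iff.mp (hw ▸ by exact_mod_cast hr)
  exact ⟨w.im, Complex.ext (by simp [hre]) (by simp)⟩

end Sign

end LameKdV

end

theorem proposition4p1 (k : ℝ) (hk : k ∈ Set.Ioo (0 : ℝ) 1) (lam : ℝ) (α : ℂ)
    (hα : LameKdV.CharacteristicEq k lam α ∨ α = LameKdV.pathAlpha k lam) :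
    (lam ∈ Set.Iio (-k ^ 2) ∪ Set.Ioo (1 - 2 * k ^ 2) (1 - k ^ 2) →
      LameKdV.jacobiTheta k α ≠ 0 ∧ LameKdV.jacobiH k α ≠ 0 ∧
        ∃ w : ℝ, LameKdV.omega k lam α = (w : ℂ)) ∧
    (lam ∈ Set.Icc (-k ^ 2) (1 - 2 * k ^ 2) →
      LameKdV.jacobiTheta k α ≠ 0 ∧ LameKdV.jacobiH k α ≠ 0 ∧
        ∃ w : ℝ, LameKdV.omega k lam α = Complex.I * (w : ℂ)) := by
  obtain ⟨t, ht, rfl⟩ := LameKdV.exists_modulus_eq hk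
  have hchar (hlam : lam < 1 - LameKdV.modulus t ^ 2) :
      LameKdV.CharacteristicEq (LameKdV.modulus t) lam α :=
    hα.elim id fun h => h ▸ LameKdV.characteristicEq_pathAlpha ht hlam.le
  have hpos := pow_pos (LameKdV.modulus_pos ht) 2
  have hle := (LameKdV.modulus_sq_lt_one ht).le
  refine ⟨fun hband => ?_, fun hgap => ?_⟩
  · have hlam : lam < 1 - LameKdV.modulus t ^ 2 :=
      hband.elim (fun h => by linarith [Set.mem_Iio.mp h]) (·.2)
    have h := hchar hlam
    exact ⟨h.1, h.jacobiH_ne_zero ht hlam.ne, LameKdV.exists_eq_ofReal_of_sq_eq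
      (h.omega_sq ht hlam.ne) (LameKdV.frequencyCubic_nonneg hle hband)⟩
  · have hlam : lam < 1 - LameKdV.modulus t ^ 2 := by linarith [hgap.2]
    have h := hchar hlam
    exact ⟨h.1, h.jacobiH_ne_zero ht hlam.ne, LameKdV.exists_eq_I_mul_ofReal_of_sq_eq
      (h.omega_sq ht hlam.ne) (LameKdV.frequencyCubic_nonpos hgap)⟩
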